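/- Let $G=(V,E)$ be a finite graph with $V \neq \emptyset$ and let $\lambda\ge 1$ be a real number (the fugacity; it corresponds to the temperature $T$ with $\lambda=e^{1/T}$). The Metropolis process on $G$ with fixed fugacity $\lambda$ is the random sequence $(I_t)_{t\ge 0}$ of independent sets of $G$ with $I_0=\emptyset$ which evolves as follows: in step $t\ge 1$ a vertex $v_t\in V$ and a number $\zeta_t\in[0,1]$ are drawn uniformly at random, all these draws being independent; if $v_t\notin I_{t-1}$, then $I_t=I_{t-1}\cup\{v_t\}$ if this set is independent and $I_t=I_{t-1}$ otherwise; if $v_t\in I_{t-1}$, then $I_t=I_{t-1}\setminus\{v_t\}$ if $\zeta_t\le 1/\lambda$ and $I_t=I_{t-1}$ otherwise. Let $\alpha(G)$ denote the size of a largest independent set of $G$, and let $2|E|/|V|$ be the average degree of $G$. **Theorem.** There are universal constants $C,C',a,b>0$ such that the following holds. Let $(d_n)_{n\ge1}$ be a sequence of real numbers with $d_n\ge C$ for all $n$ and $d_n=o(n/\log^2 n)$. Then there is a sequence of finite graphs $(G_n)$ such that for all sufficiently large $n$ (depending on the sequence $(d_n)$): 1. the number of vertices of $G_n$ lies in $[a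 n,\, b n]$, the average degree of $G_n$ lies in $[a d_n,\, b d_n]$, and $\alpha(G_n)\in\left[a\frac{n}{\log d_n},\, b\frac{n}{\log d_n}\right]$; 2. for every $\lambda\ge 1$ (which may depend on $n$), the Metropolis process $(I_t)_{t\ge0}$ on $G_n$ with fixed fugacity $\lambda$, started from the empty set, satisfies $$\mathbb{P}\left(\max_{t\le \exp\left(\frac{n}{C'd_n}\right)}|I_t|\ \ge\ C'\,\frac{\log d_n}{d_n}\,\alpha(G_n)\right)\ \le\ \exp\left(-\frac{n}{d_n\log d_n}\right).$$ -/

import Mathlib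

open MeasureTheory Filter Asymptotics

noncomputable section

/-- One step of the Metropolis process for independent sets: `I` is the current independent set,
`v` the vertex to be updated, `ζ` a number in `[0,1]`, and `fug` the fugacity
(`fug = exp (1 / T)` at temperature `T`). A vertex outside `I` is added whenever possible, and a
vertex of `I` is removed if `ζ ≤ 1 / fug`. -/
def metropolisUpdate {V : Type*} [DecidableEq V] (G : SimpleGraph V) (fug : ℝ)
    (I : Finset V) (v : V) (ζ : unitInterval) : Finset V :=
  open Classical in
  if v ∉ I then
    if G.IsIndepSet (insert v I : Finset V) then insert v I else I
  else
    if (ζ : ℝ) ≤ 1 / fug then I.erase v else I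

/-- The sequence `I_0, I_1, …` of independent sets maintained by the Metropolis process with fixed
fugacity `fug`, started from the empty set. The randomness `ω` lists the pairs
`(v_1, ζ_1), (v_2, ζ_2), …`; the pair `ω t` is used in the step from time `t` to time `t + 1`. -/
def metropolisProcess {V : Type*} [DecidableEq V] (G : SimpleGraph V) (fug : ℝ)
    (ω : ℕ → V × unitInterval) : ℕ → Finset V
  | 0 => ∅
  | t + 1 => metropolisUpdate G fug (metropolisProcess G fug ω t) (ω t).1 (ω t).2

/-- The law of the randomness: the pairs `(v_t, ζ_t)` are independent, with `v_t` uniform on the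
vertex set, `ζ_t` uniform on `[0,1]`, and `v_t`, `ζ_t` independent of each other. -/
def metropolisMeasure (V : Type*) [Fintype V] [Nonempty V] [MeasurableSpace V] :
    Measure (ℕ → V × unitInterval) :=
  Measure.infinitePi fun _ : ℕ =>
    (PMF.uniformOfFintype V).toMeasure.prod (volume : Measure unitInterval)

/-- The average degree `2|E| / |V|` of a finite graph. -/
def averageDegree {V : Type*} [Fintype V] (G : SimpleGraph V) : ℝ :=
  2 * (G.edgeSet.ncard : ℝ) / (Fintype.card V : ℝ)

end

/-! The graph is a trap: `m` cliques of size `s`, where `s` is about `d` and `m` about `3200 n / d`,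
together with `p`, about `n / log d`, single vertices, each joined completely to at most `k`
cliques, where `k` is about `3 log d`. The single vertices are independent and every clique
contributes at most one vertex, so the independence number lies between `p` and `m + p`. The joins
are chosen at random so that any `q` single vertices touch every collection of at least half of the
cliques. Most vertices lie in cliques, so the process first occupies cliques; afterwards it cannot
collect `q` single vertices without emptying many of them, and its set stays below `m + q`, a
fraction of order `log d / d` of the maximum.

Two estimates make this precise for the set of occupied cliques and single vertices, which is itself
a Markov chain. The first is drift: while fewer than `3m/4` cliques and at most `q₁` single vertices
are occupied, at least `m/8` cliques can still be entered, and `exp (R - η L)` is a supermartingale,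
where `R` counts occupied single vertices and `L` occupied cliques (`lumpedStep_exp_le`). Hence `R`
rarely exceeds `q₁` before `L` reaches `3m/4`. The second is a bottleneck: the chain is reversible
with weight `(s * fug) ^ L * fug ^ R`, so the chance of hitting a set within `T` steps is at most `T
+ 1` times the ratio of its weight to that of the starting state
(`lumpedWeight_mul_lumpedHitting_le`). A state with `R = q` has `L < m/2` by expansion, and so
weighs far less than any state with `L ≥ 3m/4`, uniformly in the fugacity
(`lumpedHitting_le_of_card_toLeft`). A backward induction on time, `lumpedHitting_bipartiteOf_le`,
adds the two bounds. -/

/-! ### Random iterations and their hitting probabilities -/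

/-- The iterates of a random map `f`, driven by the sequence `ω` and started from `y`. -/
def randomIterate {σ X : Type*} (f : σ → X → σ) (y : σ) (ω : ℕ → X) : ℕ → σ
  | 0 => y
  | t + 1 => f (randomIterate f y ω t) (ω t)

theorem measurable_randomIterate {σ X : Type*} [Finite σ] [MeasurableSpace σ]
    [DiscreteMeasurableSpace σ] [MeasurableSpace X] {f : σ → X → σ} (hf : ∀ y,
      Measurable (f y)) (y : σ) (t : ℕ) :
    Measurable fun ω => randomIterate f y ω t := by
  induction t with
  | zero => exact measurable_const
  | succ t ih =>
    have h : Measurable (fun z : σ × X => f z.1 z.2) := measurable_from_prod_countable_right hf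
    exact h.comp (ih.prodMk (measurable_pi_apply t))

theorem randomIterate_congr {σ X : Type*} (f : σ → X → σ) (y : σ) {ω ω' : ℕ → X} (t : ℕ)
    (h : ∀ i < t, ω i = ω' i) : randomIterate f y ω t = randomIterate f y ω' t := by
  induction t with
  | zero => rfl
  | succ t ih =>
    simp only [randomIterate]
    rw [ih fun i hi => h i (hi.trans t.lt_succ_self), h t t.lt_succ_self]

theorem indepFun_randomIterate {σ X : Type*} [Finite σ] [MeasurableSpace σ]
    [DiscreteMeasurableSpace σ] [MeasurableSpace X] {f : σ → X → σ} (hf : ∀ y, Measurable (f y))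
    (ν : Measure X) [IsProbabilityMeasure ν] (y : σ) (t : ℕ) :
    ProbabilityTheory.IndepFun (fun ω => randomIterate f y ω t) (fun ω : ℕ → X => ω t)
      (Measure.infinitePi fun _ : ℕ => ν) := by
  classical
  obtain ⟨x₀⟩ := nonempty_of_isProbabilityMeasure ν
  have hi := ProbabilityTheory.iIndepFun_infinitePi (P := fun _ : ℕ => ν)
    (X := fun _ x => x) (fun _ => measurable_id)
  have h := hi.indepFun_finset (Finset.range t) {t} (by simp) (fun i => measurable_pi_apply i)
  -- The first `t` steps read only the coordinates below `t`, so the default value `x₀` elsewhere is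
  -- harmless.
  let E : (Finset.range t → X) → ℕ → X := fun z i => if hi : i ∈ Finset.range t then z ⟨i,
    hi⟩ else x₀
  have hE : Measurable E := by
    refine measurable_pi_lambda _ fun i => ?_
    by_cases hi : i ∈ Finset.range t
    · simpa only [E, dif_pos hi] using measurable_pi_apply _
    · simpa only [E, dif_neg hi] using measurable_const
  have h2 := h.comp ((measurable_randomIterate hf y t).comp hE)
    (measurable_pi_apply (X := fun _ : ({t} : Finset ℕ) => X) ⟨t, by simp⟩)
  have e : (fun ω : ℕ → X => randomIterate f y ω t) =
      ((fun ω => randomIterate f y ω t) ∘ E) ∘ fun a (i : Finset.range t) => a i := by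
    funext ω
    refine randomIterate_congr f y t fun i hi => ?_
    simp [E, hi]
  rw [e]
  exact h2

/-- This is the Markov property: split according to the finitely many values of the state at time
`t`, which is independent of the input `ω t`. -/
theorem integral_randomIterate_succ {σ X : Type*} [Finite σ] [MeasurableSpace σ]
    [DiscreteMeasurableSpace σ] [MeasurableSpace X] {f : σ → X → σ} (hf : ∀ y, Measurable (f y))
    (ν : Measure X) [IsProbabilityMeasure ν] (y : σ) (g : σ → ℝ) (t : ℕ) :
    ∫ ω, g (randomIterate f y ω (t + 1)) ∂(Measure.infinitePi fun _ : ℕ => ν) =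
      ∫ ω, (∫ x, g (f (randomIterate f y ω t) x) ∂ν) ∂(Measure.infinitePi fun _ : ℕ => ν) := by
  classical
  have := Fintype.ofFinite σ
  have hY := measurable_randomIterate hf y t
  obtain ⟨c, hc⟩ : ∃ c, ∀ z, ‖g z‖ ≤ c := (Set.finite_range fun z => ‖g z‖).bddAbove.imp
    fun c hc z => hc ⟨z, rfl⟩
  have hg : Measurable g := measurable_of_finite g
  have hint : ∀ z, Integrable (fun x => g (f z x)) ν := fun z =>
    Integrable.of_bound (hg.comp (hf z)).aestronglyMeasurable c (.of_forall fun x => hc _)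
  have key : ∀ z : σ, ∫ ω, (if randomIterate f y ω t = z then (1 : ℝ) else 0) * g (f z (ω t))
      ∂(Measure.infinitePi fun _ : ℕ => ν) =
      ∫ ω, (if randomIterate f y ω t = z then (1 : ℝ) else 0) * (∫ x, g (f z x) ∂ν)
      ∂(Measure.infinitePi fun _ : ℕ => ν) := by
    intro z
    have hm : Measurable fun z' : σ => if z' = z then (1 : ℝ) else 0 := measurable_of_finite _
    have h1 := (indepFun_randomIterate hf ν y t).integral_fun_comp_mul_comp
      (f := fun z' : σ => if z' = z then (1 : ℝ) else 0) (g := fun x => g (f z x))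
      hY.aemeasurable (measurable_pi_apply t).aemeasurable hm.aestronglyMeasurable
      (hg.comp (hf z)).aestronglyMeasurable
    rw [h1, integral_mul_const]
    congr 1
    have hp := measurePreserving_eval_infinitePi (fun _ : ℕ => ν) t
    have h2 := integral_map (μ := Measure.infinitePi fun _ : ℕ => ν) hp.measurable.aemeasurable
      (hg.comp (hf z)).aestronglyMeasurable
    rw [hp.map_eq] at h2
    exact h2.symm
  have e1 : ∀ ω : ℕ → X, g (randomIterate f y ω (t + 1)) =
      ∑ z, (if randomIterate f y ω t = z then (1 : ℝ) else 0) * g (f z (ω t)) := by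
    intro ω; simp [randomIterate]
  have e2 : ∀ ω : ℕ → X, ∫ x, g (f (randomIterate f y ω t) x) ∂ν =
      ∑ z, (if randomIterate f y ω t = z then (1 : ℝ) else 0) * ∫ x, g (f z x) ∂ν := by
    intro ω; simp
  simp_rw [e1, e2]
  have hm : ∀ z, Measurable fun ω => if randomIterate f y ω t = z then (1 : ℝ) else 0 :=
    fun z => (measurable_of_finite fun z' : σ => if z' = z then (1 : ℝ) else 0).comp hY
  rw [integral_finsetSum, integral_finsetSum]
  · exact Finset.sum_congr rfl fun z _ => key z
  · intro z _
    refine Integrable.of_bound ((hm z).mul measurable_const).aestronglyMeasurable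
      ‖∫ x, g (f z x) ∂ν‖ (.of_forall fun ω => ?_)
    split_ifs <;> simp
  · intro z _
    refine Integrable.of_bound ((hm z).mul
      (hg.comp ((hf z).comp (measurable_pi_apply t)))).aestronglyMeasurable c (.of_forall fun ω =>
        ?_)
    have := hc (f z (ω t))
    split_ifs <;> simp
    · exact this
    · exact (norm_nonneg _).trans this

open Classical in
/-- The update `f` frozen on the set `B`. -/
noncomputable def freezeOn {σ X : Type*} (f : σ → X → σ) (B : Set σ) (y : σ) (x : X) : σ :=
  if y ∈ B then y else f y x

/-- Freezing changes nothing before the first entry into `B` and makes `B` absorbing, so a hit at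
any time up to `T` is visible at time `T` alone. -/
theorem randomIterate_freezeOn_mem {σ X : Type*} (f : σ → X → σ) (B : Set σ) (y : σ) (ω : ℕ → X)
    {t T : ℕ} (htT : t ≤ T) (ht : randomIterate f y ω t ∈ B) :
    randomIterate (freezeOn f B) y ω T ∈ B := by
  have key : ∀ T, randomIterate (freezeOn f B) y ω T ∈ B ∨
      ((∀ t ≤ T, randomIterate f y ω t ∉ B) ∧
        randomIterate (freezeOn f B) y ω T = randomIterate f y ω T) := by
    intro T
    induction T with
    | zero =>
      by_cases h : y ∈ B
      · exact Or.inl h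
      · exact Or.inr ⟨fun t ht => by rw [Nat.le_zero.mp ht]; exact h, rfl⟩
    | succ T ih =>
      rcases ih with h | ⟨h, e⟩
      · left
        simp only [randomIterate, freezeOn, if_pos h]
        exact h
      · have hT := h T le_rfl
        have e' : randomIterate (freezeOn f B) y ω (T + 1) = randomIterate f y ω (T + 1) := by

          simp only [randomIterate]
          rw [e, freezeOn, if_neg hT]
        by_cases hB : randomIterate f y ω (T + 1) ∈ B
        · exact Or.inl (e' ▸ hB)
        · refine Or.inr ⟨fun t ht => ?_, e'⟩
          rcases Nat.le_succ_iff.mp ht with ht | rfl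
          · exact h t ht
          · exact hB
  rcases key T with h | h
  · exact h
  · exact absurd ht (h.1 t htT)

/-- Hitting probabilities of a random iteration are bounded by a supersolution of the backward
equation. -/
theorem measureReal_exists_randomIterate_mem_le {σ X : Type*} [Finite σ] [MeasurableSpace σ]
    [DiscreteMeasurableSpace σ] [MeasurableSpace X] {f : σ → X → σ} (hf : ∀ y, Measurable (f y))
    (ν : Measure X) [IsProbabilityMeasure ν] (B : Set σ) (inv : σ → Prop) (h : ℕ → σ → ℝ)
    (hinv : ∀ y x, inv y → inv (f y x)) (h_zero : ∀ y, inv y → 0 ≤ h 0 y)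
    (h_one : ∀ y ∈ B, inv y → 1 ≤ h 0 y)
    (h_mem : ∀ r, ∀ y ∈ B, inv y → h r y ≤ h (r + 1) y)
    (h_step : ∀ r, ∀ y ∉ B, inv y → ∫ x, h r (f y x) ∂ν ≤ h (r + 1) y)
    (y : σ) (hy : inv y) (T : ℕ) :
    (Measure.infinitePi fun _ : ℕ => ν).real {ω | ∃ t ≤ T, randomIterate f y ω t ∈ B} ≤ h T y := by
  classical
  have hs : ∀ y, Measurable (freezeOn f B y) := by
    intro y
    by_cases hy : y ∈ B
    · rw [show freezeOn f B y = fun _ => y from funext fun x => if_pos hy]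
      exact measurable_const
    · rw [show freezeOn f B y = f y from funext fun x => if_neg hy]
      exact hf y
  have hinv' : ∀ ω t, inv (randomIterate (freezeOn f B) y ω t) := by
    intro ω t
    induction t with
    | zero => exact hy
    | succ t ih =>
      simp only [randomIterate, freezeOn]
      split_ifs
      · exact ih
      · exact hinv _ _ ih
  have hbd : ∀ (g : σ → ℝ) (t : ℕ), Integrable (fun ω => g (randomIterate (freezeOn f B) y ω t))
      (Measure.infinitePi fun _ : ℕ => ν) := by
    intro g t
    obtain ⟨c, hc⟩ : ∃ c, ∀ z, ‖g z‖ ≤ c := (Set.finite_range fun z => ‖g z‖).bddAbove.imp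
      fun c hc z => hc ⟨z, rfl⟩
    exact Integrable.of_bound ((measurable_of_finite g).comp
      (measurable_randomIterate hs y t)).aestronglyMeasurable c (.of_forall fun ω => hc _)
  -- With `r` as the remaining time, `h r` along the frozen process is a supermartingale; moving one
  -- step from the process to the index `r` gives the induction.
  have key : ∀ t r, ∫ ω, h r (randomIterate (freezeOn f B) y ω t)
      ∂(Measure.infinitePi fun _ : ℕ => ν) ≤ h (r + t) y := by
    intro t
    induction t with
    | zero => intro r; simp [randomIterate]
    | succ t ih =>
      intro r
      rw [integral_randomIterate_succ hs]
      refine (integral_mono (hbd (fun z => ∫ x, h r (freezeOn f B z x) ∂ν) t)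
        (hbd (h (r + 1)) t) fun ω => ?_).trans ((ih (r + 1)).trans_eq (by rw [add_right_comm,
          add_assoc]))
      have hi := hinv' ω t
      by_cases hB : randomIterate (freezeOn f B) y ω t ∈ B
      · simpa [freezeOn, hB] using h_mem r _ hB hi
      · simpa [freezeOn, hB] using h_step r _ hB hi
  have h0 := key T 0
  rw [zero_add] at h0
  refine le_trans ?_ h0
  have hm : MeasurableSet {ω : ℕ → X | randomIterate (freezeOn f B) y ω T ∈ B} :=
    measurable_randomIterate hs y T (Set.toFinite B).measurableSet
  calc _ ≤ (Measure.infinitePi fun _ : ℕ => ν).real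
        {ω | randomIterate (freezeOn f B) y ω T ∈ B} :=
        by
        refine measureReal_mono ?_
        rintro ω ⟨t, ht, htB⟩
        exact randomIterate_freezeOn_mem f B y ω ht htB
    _ = ∫ ω, Set.indicator B (fun _ => (1 : ℝ)) (randomIterate (freezeOn f B) y ω T)
          ∂(Measure.infinitePi fun _ : ℕ => ν) := by
        rw [← integral_indicator_one hm]; rfl
    _ ≤ _ := by
        refine integral_mono (hbd _ T) (hbd _ T) fun ω => ?_
        have hi := hinv' ω T
        by_cases hB : randomIterate (freezeOn f B) y ω T ∈ B
        · simpa [hB] using h_one _ hB hi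
        · simpa [hB] using h_zero _ hi

/-! ### One step of the Metropolis process -/

theorem volume_real_unitInterval_le {a : ℝ} (h0 : 0 ≤ a) (h1 : a ≤ 1) :
    (volume : Measure unitInterval).real {ζ | (ζ : ℝ) ≤ a} = a := by
  have h := unitInterval.volume_Iic ⟨a, h0, h1⟩
  have e : {ζ : unitInterval | (ζ : ℝ) ≤ a} = Set.Iic ⟨a, h0, h1⟩ := rfl
  rw [e, measureReal_def, h, ENNReal.toReal_ofReal h0]

theorem measurable_metropolisUpdate {V : Type*} [DecidableEq V] [Countable V] [MeasurableSpace V]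
    [MeasurableSingletonClass V] [MeasurableSpace (Finset V)] (G : SimpleGraph V)
    (fug : ℝ) (I : Finset V) :
    Measurable fun x : V × unitInterval => metropolisUpdate G fug I x.1 x.2 := by
  refine measurable_from_prod_countable_right fun v => ?_
  by_cases hv : v ∈ I
  · simp only [metropolisUpdate, hv, not_true_eq_false, if_false]
    exact Measurable.ite (measurableSet_le measurable_subtype_coe measurable_const)
      measurable_const measurable_const
  · simp only [metropolisUpdate, hv, not_false_eq_true, if_true]
    exact measurable_const' fun _ _ => rfl

open Classical in
theorem integral_metropolisUpdate {V : Type*} [Fintype V] [Nonempty V]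
    [MeasurableSpace V] [MeasurableSingletonClass V] (G : SimpleGraph V) {fug : ℝ}
    (hfug : 1 ≤ fug) (I : Finset V) (F : Finset V → ℝ) :
    ∫ x, F (metropolisUpdate G fug I x.1 x.2)
        ∂((PMF.uniformOfFintype V).toMeasure.prod (volume : Measure unitInterval)) =
      (∑ v, if v ∉ I then F (if G.IsIndepSet (insert v I : Finset V) then insert v I else I)
        else fug⁻¹ * F (I.erase v) + (1 - fug⁻¹) * F I) / Fintype.card V := by
  let _ : MeasurableSpace (Finset V) := ⊤
  obtain ⟨c, hc⟩ : ∃ c, ∀ z, ‖F z‖ ≤ c := (Set.finite_range fun z => ‖F z‖).bddAbove.imp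
    fun c hc z => hc ⟨z, rfl⟩
  have hF : Measurable F := measurable_from_top
  have hm : Measurable fun x : V × unitInterval => F (metropolisUpdate G fug I x.1 x.2) :=
    hF.comp (measurable_metropolisUpdate G fug I)
  rw [integral_prod _ (Integrable.of_bound hm.aestronglyMeasurable c (.of_forall fun _ => hc _)),
    PMF.integral_eq_sum, Finset.sum_div]
  refine Finset.sum_congr rfl fun v _ => ?_
  rw [PMF.uniformOfFintype_apply, smul_eq_mul, ENNReal.toReal_inv, ENNReal.toReal_natCast,
    div_eq_inv_mul]
  congr 1
  by_cases hv : v ∈ I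
  · simp only [metropolisUpdate, hv, not_true_eq_false, if_false]
    have h0 : 0 ≤ 1 / fug := by positivity
    have h1 : 1 / fug ≤ 1 := by rw [div_le_one (by linarith)]; exact hfug
    have hS : MeasurableSet {ζ : unitInterval | (ζ : ℝ) ≤ 1 / fug} :=
      measurableSet_le measurable_subtype_coe measurable_const
    have e : (fun ζ : unitInterval => F (if (ζ : ℝ) ≤ 1 / fug then I.erase v else I)) =
        fun ζ => Set.indicator {ζ : unitInterval | (ζ : ℝ) ≤ 1 / fug}
          (fun _ => F (I.erase v) - F I) ζ + F I := by
      funext ζ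
      by_cases h : (ζ : ℝ) ≤ 1 / fug
      · rw [if_pos h, Set.indicator_of_mem (by exact h)]; ring
      · rw [if_neg h, Set.indicator_of_notMem (by exact h)]; ring
    rw [e, integral_add ((integrable_const _).indicator hS) (integrable_const _),
      integral_indicator_const _ hS, volume_real_unitInterval_le h0 h1]
    simp
    ring
  · simp only [metropolisUpdate, hv, not_false_eq_true, if_true]
    simp

/-! ### Blow-ups and the lumped chain -/

/-- The graph obtained from `H` by replacing every vertex `j` by a clique on the fibre of `π` over
`j`, and every edge by a complete bipartite graph. -/
def SimpleGraph.blowUp {V J : Type*} (H : SimpleGraph J) (π : V → J) : SimpleGraph V where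
  Adj v w := v ≠ w ∧ (π v = π w ∨ H.Adj (π v) (π w))
  symm := ⟨fun _ _ h => ⟨h.1.symm, h.2.imp Eq.symm fun h => h.symm⟩⟩
  loopless := ⟨fun _ h => h.1 rfl⟩

theorem SimpleGraph.isIndepSet_blowUp_iff {V J : Type*} (H : SimpleGraph J) (π : V → J)
    (I : Set V) : (H.blowUp π).IsIndepSet I ↔ Set.InjOn π I ∧ H.IsIndepSet (π '' I) := by
  constructor
  · refine fun h => ⟨fun v hv w hw e => ?_, ?_⟩
    · by_contra hne
      exact h hv hw hne ⟨hne, Or.inl e⟩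
    · rintro _ ⟨v, hv, rfl⟩ _ ⟨w, hw, rfl⟩ hne hadj
      have hne' : v ≠ w := fun e => hne (e ▸ rfl)
      exact h hv hw hne' ⟨hne', Or.inr hadj⟩
  · rintro ⟨hinj, h⟩ v hv w hw hne ⟨_, e | hadj⟩
    · exact hne (hinj hv hw e)
    · exact h ⟨v, hv, rfl⟩ ⟨w, hw, rfl⟩ (fun e => hne (hinj hv hw e)) hadj

theorem isIndepSet_metropolisUpdate {V : Type*} [DecidableEq V] (G : SimpleGraph V) (fug : ℝ)
    {I : Finset V} (hI : G.IsIndepSet (I : Set V)) (v : V) (ζ : unitInterval) :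
    G.IsIndepSet (metropolisUpdate G fug I v ζ : Set V) := by
  unfold metropolisUpdate
  split_ifs <;> first | exact hI | assumption | exact hI.mono (by simp)

open Classical in
/-- The transition operator of the Metropolis process on the blow-up of `H` with clique sizes `c`,
acting on functions of the set of occupied cliques. -/
noncomputable def lumpedStep {J : Type*} [Fintype J] (H : SimpleGraph J) (c : J → ℝ) (fug : ℝ)
    (g : Finset J → ℝ) (A : Finset J) : ℝ :=
  (∑ j, if j ∉ A then c j * g (if H.IsIndepSet (insert j A : Finset J) then insert j A else A)
    else fug⁻¹ * g (A.erase j) + (c j - fug⁻¹) * g A) / ∑ j, c j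

open Classical in
-- Vertices of one clique are interchangeable: a vacant clique is entered through any of its `c j`
-- vertices or through none of them, while an occupied one can be left only through its single
-- occupant. So the projection to occupied cliques is Markov.
theorem integral_metropolisUpdate_blowUp {V J : Type*} [Fintype V] [Nonempty V]
    [MeasurableSpace V] [MeasurableSingletonClass V] [Fintype J] (H : SimpleGraph J) (π : V → J)
    {fug : ℝ} (hfug : 1 ≤ fug) {I : Finset V} (hI : (H.blowUp π).IsIndepSet (I : Set V))
    (g : Finset J → ℝ) :
    ∫ x, g ((metropolisUpdate (H.blowUp π) fug I x.1 x.2).image π)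
        ∂((PMF.uniformOfFintype V).toMeasure.prod (volume : Measure unitInterval)) =
      lumpedStep H (fun j => ((Finset.univ.filter fun v => π v = j).card : ℝ)) fug g
        (I.image π) := by
  rw [integral_metropolisUpdate (H.blowUp π) hfug I fun I => g (I.image π), lumpedStep]
  obtain ⟨hinj, hind⟩ := (H.isIndepSet_blowUp_iff π I).1 hI
  congr 1
  · rw [← Finset.sum_fiberwise Finset.univ π]
    refine Finset.sum_congr rfl fun j _ => ?_
    by_cases hj : j ∈ I.image π
    · simp only [hj, not_true_eq_false, if_false]
      obtain ⟨w, hw, rfl⟩ := Finset.mem_image.1 hj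
      have hwm : w ∈ Finset.univ.filter fun v => π v = π w := by simp
      rw [← Finset.add_sum_erase _ _ hwm]
      have e1 : (I.erase w).image π = (I.image π).erase (π w) := by
        ext i
        simp only [Finset.mem_image, Finset.mem_erase]
        constructor
        · rintro ⟨v, ⟨hne, hv⟩, rfl⟩
          exact ⟨fun e => hne (hinj hv hw e), v, hv, rfl⟩
        · rintro ⟨hne, v, hv, rfl⟩
          exact ⟨v, ⟨fun e => hne (e ▸ rfl), hv⟩, rfl⟩
      -- The other vertices of an occupied clique are blocked by its occupant.
      have e2 : ∀ v ∈ (Finset.univ.filter fun v => π v = π w).erase w,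
          (if v ∉ I then g ((if (H.blowUp π).IsIndepSet (insert v I : Finset V) then insert v I
            else I).image π) else fug⁻¹ * g ((I.erase v).image π) + (1 - fug⁻¹) * g (I.image π)) =
          g (I.image π) := by
        intro v hv
        obtain ⟨hvw, hv⟩ := Finset.mem_erase.1 hv
        have hπ : π v = π w := (Finset.mem_filter.1 hv).2
        have hvI : v ∉ I := fun h => hvw (hinj h hw hπ)
        have hni : ¬ (H.blowUp π).IsIndepSet (insert v I : Finset V) := fun h =>
          h (by simp) (by simp [hw]) hvw ⟨hvw, Or.inl hπ⟩
        rw [if_pos hvI, if_neg hni]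
      rw [Finset.sum_congr rfl e2, Finset.sum_const, Finset.card_erase_of_mem hwm, nsmul_eq_mul,
        Nat.cast_sub (Finset.card_pos.2 ⟨w, hwm⟩)]
      simp only [hw, not_true_eq_false, if_false, e1]
      push_cast
      ring
    · simp only [hj, not_false_eq_true, if_true]
      rw [← nsmul_eq_mul, ← Finset.sum_const]
      refine Finset.sum_congr rfl fun v hv => ?_
      obtain rfl : π v = j := (Finset.mem_filter.1 hv).2
      have hvI : v ∉ I := fun h => hj (Finset.mem_image_of_mem π h)
      have hiff : (H.blowUp π).IsIndepSet (insert v I : Finset V) ↔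
          H.IsIndepSet (insert (π v) (I.image π) : Finset J) := by
        rw [H.isIndepSet_blowUp_iff]
        have hinj' : Set.InjOn π (insert v I : Finset V) := by
          rw [Finset.coe_insert, Set.injOn_insert (by simpa using hvI)]
          exact ⟨hinj, by simpa using hj⟩
        rw [and_iff_right hinj', Finset.coe_insert, Finset.coe_insert, Set.image_insert_eq,
          Finset.coe_image]
      by_cases h : (H.blowUp π).IsIndepSet (insert v I : Finset V)
      · rw [if_pos hvI, if_pos h, if_pos (hiff.1 h), Finset.image_insert]
      · rw [if_pos hvI, if_neg h, if_neg fun h' => h (hiff.2 h')]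
  · have h := Finset.card_eq_sum_card_fiberwise (f := π) (s := Finset.univ) (t := Finset.univ)
      fun _ _ => Finset.mem_coe.2 (Finset.mem_univ _)
    rw [Finset.card_univ] at h
    rw [h]
    push_cast
    congr! 2

theorem metropolisProcess_eq_randomIterate {V : Type*} [DecidableEq V] (G : SimpleGraph V)
    (fug : ℝ) (ω : ℕ → V × unitInterval) (t : ℕ) :
    metropolisProcess G fug ω t =
      randomIterate (fun I x => metropolisUpdate G fug I x.1 x.2) ∅ ω t := by
  induction t with
  | zero => rfl
  | succ t ih => simp only [metropolisProcess, randomIterate, ih]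

open Classical in
/-- The probability that the lumped process started from `A` hits `B` within `r` steps. -/
noncomputable def lumpedHitting {J : Type*} [Fintype J] (H : SimpleGraph J) (c : J → ℝ) (fug : ℝ)
    (B : Set (Finset J)) : ℕ → Finset J → ℝ
  | 0 => fun A => if A ∈ B then 1 else 0
  | r + 1 => fun A => if A ∈ B then 1 else lumpedStep H c fug (lumpedHitting H c fug B r) A

theorem lumpedHitting_of_mem {J : Type*} [Fintype J] (H : SimpleGraph J) (c : J → ℝ) (fug : ℝ)
    {B : Set (Finset J)} {A : Finset J} (hA : A ∈ B) (r : ℕ) : lumpedHitting H c fug B r A = 1 := by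
  cases r <;> simp [lumpedHitting, hA]

/-- `lumpedHitting` solves the backward equation with equality, so it serves as the supersolution
`h`. -/
theorem measureReal_metropolisProcess_blowUp_le {V J : Type*} [Fintype V] [Nonempty V]
    [DecidableEq V] [DecidableEq J] [MeasurableSpace V] [MeasurableSingletonClass V] [Fintype J]
    (H : SimpleGraph J)
    (π : V → J) {c : J → ℝ} (hc : ∀ j, c j = ((Finset.univ.filter fun v => π v = j).card : ℝ))
    {fug : ℝ} (hfug : 1 ≤ fug) (B : Set (Finset J)) (T : ℕ) :
    (metropolisMeasure V).real
      {ω | ∃ t ≤ T, (metropolisProcess (H.blowUp π) fug ω t).image π ∈ B} ≤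
      lumpedHitting H c fug B T ∅ := by
  let _ : MeasurableSpace (Finset V) := ⊤
  have _ : DiscreteMeasurableSpace (Finset V) := ⟨fun _ => trivial⟩
  have hm : ∀ I : Finset V, Measurable ((fun (I : Finset V) (x : V × unitInterval) =>
      metropolisUpdate (H.blowUp π) fug I x.1 x.2) I) := measurable_metropolisUpdate _ fug
  have hind : (H.blowUp π).IsIndepSet ((∅ : Finset V) : Set V) := by simp [SimpleGraph.IsIndepSet]
  have key := measureReal_exists_randomIterate_mem_le hm
    ((PMF.uniformOfFintype V).toMeasure.prod (volume : Measure unitInterval))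
    {I | I.image π ∈ B} (fun I => (H.blowUp π).IsIndepSet (I : Set V))
    (fun r I => lumpedHitting H c fug B r (I.image π))
    (fun I x hI => isIndepSet_metropolisUpdate _ fug hI x.1 x.2)
    (fun I _ => by simp only [lumpedHitting]; split_ifs <;> simp)
    (fun I hI _ => (lumpedHitting_of_mem H c fug hI 0).ge)
    (fun r I hI _ => ((lumpedHitting_of_mem H c fug (B := B) hI r).trans
      (lumpedHitting_of_mem H c fug (B := B) hI (r + 1)).symm).le)
    (fun r I hI hind => ?_) ∅ hind T
  · simp only [metropolisProcess_eq_randomIterate]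
    exact key
  · have h := integral_metropolisUpdate_blowUp H π hfug hind (lumpedHitting H c fug B r)
    simp only [lumpedHitting]
    rw [if_neg (by exact hI)]
    refine Eq.le ?_
    convert h using 3
    · congr!
    · rename_i j
      rw [hc]
      congr!

/-! ### Reversibility and hitting bounds -/

/-- The stationary weight of the lumped process. -/
noncomputable def lumpedWeight {J : Type*} (H : SimpleGraph J) (c : J → ℝ) (fug : ℝ)
    (A : Finset J) : ℝ :=
  open Classical in if H.IsIndepSet (A : Set J) then ∏ j ∈ A, c j * fug else 0

open Classical in
-- Detailed balance: for each `j`, the weight of `A` times the rate `c j` of adding `j` equals the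
-- weight of `insert j A` times the rate `fug⁻¹` of removing it.
theorem sum_lumpedWeight_mul_lumpedStep {J : Type*} [Fintype J] (H : SimpleGraph J)
    (c : J → ℝ) {fug : ℝ} (hfug : fug ≠ 0) (hc : ∑ j, c j ≠ 0) (g : Finset J → ℝ) :
    ∑ A, lumpedWeight H c fug A * lumpedStep H c fug g A = ∑ A, lumpedWeight H c fug A * g A := by
  simp only [lumpedStep, mul_div_assoc', Finset.mul_sum]
  rw [← Finset.sum_div, div_eq_iff hc, Finset.sum_comm, Finset.mul_sum]
  refine Finset.sum_congr rfl fun j _ => ?_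
  -- Pair every `A` avoiding `j` with `insert j A`; the update at `j` acts within each pair.
  have key : ∀ F : Finset J → ℝ, ∑ A, F A =
      ∑ A ∈ (Finset.univ.erase j).powerset, (F A + F (insert j A)) := by
    intro F
    rw [Finset.sum_add_distrib, ← Finset.sum_powerset_insert (by simp),
      Finset.insert_erase (by simp),
      Finset.powerset_univ]
  rw [key, key, Finset.sum_mul]
  refine Finset.sum_congr rfl fun A hA => ?_
  have hj : j ∉ A := fun h => by simpa using Finset.mem_powerset.1 hA h
  simp only [hj, not_false_eq_true, if_true, Finset.mem_insert_self, not_true_eq_false, if_false,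
    Finset.erase_insert hj]
  by_cases h : H.IsIndepSet ((insert j A : Finset J) : Set J)
  · have hA' : H.IsIndepSet (A : Set J) := h.mono (by simp)
    simp only [lumpedWeight, h, hA', if_true, Finset.prod_insert hj]
    generalize ∏ x ∈ A, c x * fug = P
    field_simp
    ring
  · simp only [lumpedWeight, h, if_false]
    ring

open Classical in
-- The condition `fug⁻¹ ≤ c j` makes the holding coefficient `c j - fug⁻¹` nonnegative.
theorem lumpedStep_mono {J : Type*} [Fintype J] (H : SimpleGraph J) {c : J → ℝ} {fug : ℝ}
    (hfug : 0 < fug) (hc : ∀ j, fug⁻¹ ≤ c j) {g g' : Finset J → ℝ}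
    (h : ∀ A : Finset J, H.IsIndepSet (A : Set J) → g A ≤ g' A) {A : Finset J}
    (hA : H.IsIndepSet (A : Set J)) : lumpedStep H c fug g A ≤ lumpedStep H c fug g' A := by
  have h0 : 0 ≤ fug⁻¹ := by positivity
  refine div_le_div_of_nonneg_right (Finset.sum_le_sum fun j _ => ?_)
    (Finset.sum_nonneg fun j _ => h0.trans (hc j))
  have hcj := sub_nonneg.2 (hc j)
  split_ifs with h1 h2
  · exact add_le_add (mul_le_mul_of_nonneg_left (h _ (hA.mono (by simp))) h0)
      (mul_le_mul_of_nonneg_left (h _ hA) hcj)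
  · exact mul_le_mul_of_nonneg_left (h _ h2) (h0.trans (hc j))
  · exact mul_le_mul_of_nonneg_left (h _ hA) (h0.trans (hc j))

theorem lumpedStep_nonneg {J : Type*} [Fintype J] (H : SimpleGraph J) {c : J → ℝ} {fug : ℝ}
    (hfug : 0 < fug) (hc : ∀ j, fug⁻¹ ≤ c j) {g : Finset J → ℝ} (hg : ∀ A, 0 ≤ g A)
    (A : Finset J) : 0 ≤ lumpedStep H c fug g A := by
  have h0 : 0 ≤ fug⁻¹ := by positivity
  refine div_nonneg (Finset.sum_nonneg fun j _ => ?_) (Finset.sum_nonneg fun j _ => h0.trans (hc j))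
  have hcj := sub_nonneg.2 (hc j)
  have hcj' := h0.trans (hc j)
  split_ifs
  · exact add_nonneg (mul_nonneg h0 (hg _)) (mul_nonneg hcj (hg _))
  · exact mul_nonneg hcj' (hg _)
  · exact mul_nonneg hcj' (hg _)

theorem lumpedStep_mul_add_const {J : Type*} [Fintype J] (H : SimpleGraph J) {c : J → ℝ} (fug : ℝ)
    (hc : ∑ j, c j ≠ 0) (g : Finset J → ℝ) (a b : ℝ) (A : Finset J) :
    lumpedStep H c fug (fun A => a * g A + b) A = a * lumpedStep H c fug g A + b := by
  simp only [lumpedStep]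
  rw [mul_div_assoc', div_add' _ _ _ hc, Finset.mul_sum, Finset.mul_sum, ← Finset.sum_add_distrib]
  congr 1
  refine Finset.sum_congr rfl fun j _ => ?_
  split_ifs <;> ring

theorem lumpedHitting_nonneg {J : Type*} [Fintype J] (H : SimpleGraph J) {c : J → ℝ} {fug : ℝ}
    (hfug : 0 < fug) (hc : ∀ j, fug⁻¹ ≤ c j) (B : Set (Finset J)) (r : ℕ) (A : Finset J) :
    0 ≤ lumpedHitting H c fug B r A := by
  induction r generalizing A with
  | zero => simp only [lumpedHitting]; split_ifs <;> simp
  | succ r ih =>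
    simp only [lumpedHitting]
    split_ifs
    · simp
    · exact lumpedStep_nonneg H hfug hc ih A

theorem lumpedHitting_le_one {J : Type*} [Fintype J] (H : SimpleGraph J) {c : J → ℝ} {fug : ℝ}
    (hfug : 0 < fug) (hc : ∀ j, fug⁻¹ ≤ c j) (hc0 : ∑ j, c j ≠ 0) (B : Set (Finset J)) (r : ℕ)
    {A : Finset J} (hA : H.IsIndepSet (A : Set J)) : lumpedHitting H c fug B r A ≤ 1 := by
  induction r generalizing A with
  | zero => simp only [lumpedHitting]; split_ifs <;> simp
  | succ r ih =>
    simp only [lumpedHitting]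
    split_ifs
    · exact le_rfl
    · have h1 := lumpedStep_mul_add_const H fug hc0 (fun _ => 0) 0 1 A
      have h2 := lumpedStep_mono H hfug hc (g := lumpedHitting H c fug B r)
        (g' := fun A => 0 * 0 + 1) (fun A hA => by simpa using ih hA) hA
      exact h2.trans (by rw [h1]; simp)

theorem lumpedWeight_nonneg {J : Type*} (H : SimpleGraph J) {c : J → ℝ} {fug : ℝ}
    (hfug : 0 ≤ fug) (hc : ∀ j, 0 ≤ c j) (A : Finset J) : 0 ≤ lumpedWeight H c fug A := by
  unfold lumpedWeight
  split_ifs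
  · exact Finset.prod_nonneg fun j _ => mul_nonneg (hc j) hfug
  · exact le_rfl

open Classical in
-- Averaged over the stationary weight, the hitting function grows by at most the weight of `B` per
-- step, since the transition operator preserves the average. Dropping all terms but one gives the
-- bound from a fixed start.
theorem lumpedWeight_mul_lumpedHitting_le {J : Type*} [Fintype J] (H : SimpleGraph J)
    {c : J → ℝ} {fug : ℝ} (hfug : 0 < fug) (hc : ∀ j, fug⁻¹ ≤ c j) (hc0 : ∑ j, c j ≠ 0)
    (B : Set (Finset J)) (r : ℕ) (A : Finset J) :
    lumpedWeight H c fug A * lumpedHitting H c fug B r A ≤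
      (r + 1) * ∑ A', B.indicator (lumpedWeight H c fug) A' := by
  have h0 : 0 ≤ fug⁻¹ := by positivity
  have hw := lumpedWeight_nonneg H hfug.le fun j => h0.trans (hc j)
  have key : ∀ r : ℕ, ∑ A, lumpedWeight H c fug A * lumpedHitting H c fug B r A ≤
      (r + 1) * ∑ A', B.indicator (lumpedWeight H c fug) A' := by
    intro r
    induction r with
    | zero => simp [lumpedHitting, Set.indicator_apply]
    | succ r ih =>
      have h1 : ∀ A, lumpedWeight H c fug A * lumpedHitting H c fug B (r + 1) A ≤
          B.indicator (lumpedWeight H c fug) A +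
          lumpedWeight H c fug A * lumpedStep H c fug (lumpedHitting H c fug B r) A := by
        intro A
        have hs := lumpedStep_nonneg H hfug hc (lumpedHitting_nonneg H hfug hc B r) A
        simp only [lumpedHitting, Set.indicator_apply]
        split_ifs
        · nlinarith [mul_nonneg (hw A) hs]
        · simp
      refine (Finset.sum_le_sum fun A _ => h1 A).trans ?_
      rw [Finset.sum_add_distrib, sum_lumpedWeight_mul_lumpedStep H c hfug.ne' hc0]
      push_cast
      linarith
  refine (Finset.single_le_sum (f := fun A => lumpedWeight H c fug A *
    lumpedHitting H c fug B r A) (fun A _ => mul_nonneg (hw A)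
      (lumpedHitting_nonneg H hfug hc B r A)) (Finset.mem_univ A)).trans (key r)

/-! ### The bottleneck when most cliques are occupied -/

/-- The bipartite graph with parts `α` and `β` in which `x : β` has the neighbourhood `Nb x`. -/
def bipartiteOf {α β : Type*} (Nb : β → Finset α) : SimpleGraph (α ⊕ β) where
  Adj
    | .inl i, .inr x => i ∈ Nb x
    | .inr x, .inl i => i ∈ Nb x
    | _, _ => False
  symm := ⟨by rintro (i | x) (j | y) h <;> exact h⟩
  loopless := ⟨by rintro (i | x) h <;> exact h⟩

theorem isIndepSet_bipartiteOf_iff {α β : Type*} (Nb : β → Finset α) (A : Finset (α ⊕ β)) :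
    (bipartiteOf Nb).IsIndepSet (A : Set (α ⊕ β)) ↔
      ∀ x ∈ A.toRight, ∀ i ∈ Nb x, i ∉ A.toLeft := by
  constructor
  · intro h x hx i hi hiA
    exact h (Finset.mem_coe.2 (Finset.mem_toLeft.1 hiA)) (Finset.mem_coe.2 (Finset.mem_toRight.1
      hx))
      (by simp) hi
  · rintro h (i | x) hi (j | y) hj hne hadj
    · exact hadj
    · exact h y (Finset.mem_toRight.2 hj) i hadj (Finset.mem_toLeft.2 hi)
    · exact h x (Finset.mem_toRight.2 hi) j hadj (Finset.mem_toLeft.2 hj)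
    · exact hadj

/-- Clique sizes: `s` on the left part, `1` on the right part. -/
def cliqueSizes (α β : Type*) (s : ℕ) : α ⊕ β → ℝ := Sum.elim (fun _ => (s : ℝ)) fun _ => 1

theorem lumpedWeight_bipartiteOf {α β : Type*} (Nb : β → Finset α) (s : ℕ) (fug : ℝ)
    {A : Finset (α ⊕ β)} (hA : (bipartiteOf Nb).IsIndepSet (A : Set (α ⊕ β))) :
    lumpedWeight (bipartiteOf Nb) (cliqueSizes α β s) fug A =
      (s * fug) ^ A.toLeft.card * fug ^ A.toRight.card := by
  rw [lumpedWeight, if_pos hA]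
  conv_lhs => rw [← Finset.toLeft_disjSum_toRight (u := A), Finset.prod_disjSum]
  simp [cliqueSizes]

theorem sum_cliqueSizes (α β : Type*) [Fintype α] [Fintype β] (s : ℕ) :
    ∑ j, cliqueSizes α β s j = Fintype.card α * s + Fintype.card β := by
  simp [cliqueSizes]

theorem card_filter_card_toRight_le (α β : Type*) [Fintype α] [Fintype β] (q : ℕ) :
    (Finset.univ.filter fun A : Finset (α ⊕ β) => A.toRight.card = q).card ≤
      2 ^ Fintype.card α * (Fintype.card β).choose q := by
  classical
  have h : (Finset.univ.filter fun A : Finset (α ⊕ β) => A.toRight.card = q).card ≤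
      ((Finset.univ : Finset (Finset α)) ×ˢ (Finset.powersetCard q (Finset.univ : Finset β))).card
        := by
    refine Finset.card_le_card_of_injOn (fun A => (A.toLeft, A.toRight)) ?_ ?_
    · intro A hA
      have hA := (Finset.mem_filter.1 (Finset.mem_coe.1 hA)).2
      simp [Finset.mem_powersetCard, hA]
    · intro A _ A' _ h
      obtain ⟨h1, h2⟩ := Prod.mk.inj h
      rw [← Finset.toLeft_disjSum_toRight (u := A), h1, h2, Finset.toLeft_disjSum_toRight]
  simpa [Finset.card_product, Finset.card_powersetCard] using h

open Classical in
-- Compare weights: each target state loses at least `q + r` cliques relative to `A`, hence a factor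
-- `(s * fug) ^ (q + r)`, and regains only `fug ^ q`. The factor `2 ^ |α| * choose` bounds the
-- number of target states.
theorem lumpedHitting_le_of_card_toLeft {α β : Type*} [Fintype α] [Fintype β] (Nb : β → Finset α)
    {s q r : ℕ} {fug : ℝ} (hfug : 1 ≤ fug) (hs : 1 ≤ s)
    (hexp : ∀ Q : Finset β, Q.card = q → ∀ W : Finset α, Fintype.card α ≤ 2 * W.card →
      ∃ x ∈ Q, ∃ i ∈ Nb x, i ∈ W)
    (hr : 4 * (q + r) ≤ Fintype.card α) (T : ℕ) {A : Finset (α ⊕ β)}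
    (hA : (bipartiteOf Nb).IsIndepSet (A : Set (α ⊕ β)))
    (hcard : 3 * Fintype.card α ≤ 4 * A.toLeft.card) (hα : 0 < Fintype.card α) :
    lumpedHitting (bipartiteOf Nb) (cliqueSizes α β s) fug {A | A.toRight.card = q} T A ≤
      (T + 1) * (2 ^ Fintype.card α * (Fintype.card β).choose q / s ^ (q + r)) := by
  have hf0 : 0 < fug := by linarith
  have hs' : (1 : ℝ) ≤ s := by exact_mod_cast hs
  have hinv : fug⁻¹ ≤ 1 := inv_le_one_of_one_le₀ hfug
  have hc : ∀ j, fug⁻¹ ≤ cliqueSizes α β s j := by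
    rintro (i | x)
    · exact hinv.trans hs'
    · exact hinv
  have hc0 : ∑ j, cliqueSizes α β s j ≠ 0 := by
    rw [sum_cliqueSizes]
    positivity
  have hsf : 1 ≤ (s : ℝ) * fug := one_le_mul_of_one_le_of_one_le hs' hfug
  have hwA := lumpedWeight_bipartiteOf Nb s fug hA
  have hwpos : 0 < lumpedWeight (bipartiteOf Nb) (cliqueSizes α β s) fug A := by
    rw [hwA]; positivity
  have hpt : ∀ A' : Finset (α ⊕ β), A'.toRight.card = q →
      lumpedWeight (bipartiteOf Nb) (cliqueSizes α β s) fug A' ≤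
      lumpedWeight (bipartiteOf Nb) (cliqueSizes α β s) fug A / s ^ (q + r) := by
    intro A' hq
    by_cases hA' : (bipartiteOf Nb).IsIndepSet (A' : Set (α ⊕ β))
    · have hlt : 2 * A'.toLeft.card < Fintype.card α := by
        by_contra hge
        obtain ⟨x, hx, i, hi, hiW⟩ := hexp A'.toRight hq A'.toLeft (not_lt.1 hge)
        exact (isIndepSet_bipartiteOf_iff Nb A').1 hA' x hx i hi hiW
      -- `A'` occupies less than half of the cliques and `A` at least three quarters; `q + r` is at
      -- most the remaining quarter.
      have hle : A'.toLeft.card + (q + r) ≤ A.toLeft.card := by omega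
      rw [lumpedWeight_bipartiteOf Nb s fug hA', hwA, hq, le_div_iff₀ (by positivity)]
      -- Raising `fug ^ q` to `fug ^ (q + r)` completes a power of `s * fug`, which makes the ratio
      -- independent of the fugacity.
      calc ((s : ℝ) * fug) ^ A'.toLeft.card * fug ^ q * s ^ (q + r)
          ≤ (s * fug) ^ A'.toLeft.card * fug ^ (q + r) * s ^ (q + r) := by
            gcongr
            · omega
        _ = (s * fug) ^ (A'.toLeft.card + (q + r)) * 1 := by
            rw [pow_add _ A'.toLeft.card, mul_pow (s : ℝ) fug (q + r)]; ring
        _ ≤ (s * fug) ^ A.toLeft.card * fug ^ A.toRight.card := by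
            gcongr
            exact one_le_pow₀ hfug
    · rw [lumpedWeight, if_neg hA']
      positivity
  have h := lumpedWeight_mul_lumpedHitting_le (bipartiteOf Nb) hf0 hc hc0
    {A | A.toRight.card = q} T A
  have hsum : ∑ A', {A : Finset (α ⊕ β) | A.toRight.card = q}.indicator
      (lumpedWeight (bipartiteOf Nb) (cliqueSizes α β s) fug) A' ≤
      (2 ^ Fintype.card α * (Fintype.card β).choose q) *
        (lumpedWeight (bipartiteOf Nb) (cliqueSizes α β s) fug A / s ^ (q + r)) := by
    calc _ ≤ ∑ A' : Finset (α ⊕ β), if A'.toRight.card = q then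
          lumpedWeight (bipartiteOf Nb) (cliqueSizes α β s) fug A / s ^ (q + r) else 0 := by
          refine Finset.sum_le_sum fun A' _ => ?_
          by_cases hq : A'.toRight.card = q
          · rw [Set.indicator_of_mem (by exact hq), if_pos hq]
            exact hpt A' hq
          · rw [Set.indicator_of_notMem (by exact hq), if_neg hq]
      _ ≤ _ := by
          rw [← Finset.sum_filter, Finset.sum_const, nsmul_eq_mul]
          exact mul_le_mul_of_nonneg_right
            (by exact_mod_cast card_filter_card_toRight_le α β q) (by positivity)
  have hT : (0 : ℝ) ≤ T + 1 := by positivity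
  refine le_of_mul_le_mul_left (h.trans ((mul_le_mul_of_nonneg_left hsum hT).trans_eq ?_)) hwpos
  ring

/-! ### The drift towards occupied cliques -/

theorem isIndepSet_insert_inl {α β : Type*} [DecidableEq (α ⊕ β)] (Nb : β → Finset α)
    {A : Finset (α ⊕ β)} (hA : (bipartiteOf Nb).IsIndepSet (A : Set (α ⊕ β))) {i : α}
    (hi : ∀ x ∈ A.toRight, i ∉ Nb x) :
    (bipartiteOf Nb).IsIndepSet ((insert (Sum.inl i) A : Finset (α ⊕ β)) : Set (α ⊕ β)) := by
  rw [isIndepSet_bipartiteOf_iff] at hA ⊢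
  intro x hx j hj hjA
  have hx' : x ∈ A.toRight := by simpa using hx
  rw [Finset.mem_toLeft, Finset.mem_insert] at hjA
  rcases hjA with h | h
  · exact hi x hx' (Sum.inl_injective h ▸ hj)
  · exact hA x hx' j hj (Finset.mem_toLeft.2 h)

open Classical in
/-- The contribution of the clique `j` to `lumpedStep`. -/
noncomputable def lumpedTerm {J : Type*} (H : SimpleGraph J) (c : J → ℝ) (fug : ℝ)
    (g : Finset J → ℝ) (A : Finset J) (j : J) : ℝ :=
  if j ∉ A then c j * g (if H.IsIndepSet (insert j A : Finset J) then insert j A else A)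
    else fug⁻¹ * g (A.erase j) + (c j - fug⁻¹) * g A

theorem lumpedStep_eq_sum_lumpedTerm {J : Type*} [Fintype J] (H : SimpleGraph J) (c : J → ℝ)
    (fug : ℝ) (g : Finset J → ℝ) (A : Finset J) :
    lumpedStep H c fug g A = (∑ j, lumpedTerm H c fug g A j) / ∑ j, c j := rfl

theorem lumpedTerm_of_mem {J : Type*} [DecidableEq J] (H : SimpleGraph J) (c : J → ℝ) (fug : ℝ)
    (g : Finset J → ℝ) {A : Finset J} {j : J} (h : j ∈ A) :
    lumpedTerm H c fug g A j = fug⁻¹ * g (A.erase j) + (c j - fug⁻¹) * g A := by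
  rw [lumpedTerm, if_neg (not_not.2 h)]
  congr!

theorem lumpedTerm_of_isIndepSet {J : Type*} [DecidableEq J] (H : SimpleGraph J) (c : J → ℝ)
    (fug : ℝ) (g : Finset J → ℝ) {A : Finset J} {j : J} (h : j ∉ A)
    (hI : H.IsIndepSet ((insert j A : Finset J) : Set J)) :
    lumpedTerm H c fug g A j = c j * g (insert j A) := by
  rw [lumpedTerm, if_pos h, if_pos (by convert hI)]
  congr!

theorem lumpedTerm_of_not_isIndepSet {J : Type*} [DecidableEq J] (H : SimpleGraph J) (c : J → ℝ)
    (fug : ℝ) (g : Finset J → ℝ) {A : Finset J} {j : J} (h : j ∉ A)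
    (hI : ¬ H.IsIndepSet ((insert j A : Finset J) : Set J)) :
    lumpedTerm H c fug g A j = c j * g A := by
  rw [lumpedTerm, if_pos h, if_neg (by convert hI)]

open Classical in
-- Relative to the present value and before normalisation, each occupied clique costs at most `2η`,
-- each single vertex at most `2`, and each of the at least `|α| / 8` free cliques gains `s * η /
-- 2`. The total gain is at least `|α| * s * η / 16`; one half pays for the cliques because `s ≥
-- 64`, the other for the single vertices by `hη`.
theorem lumpedStep_exp_le {α β : Type*} [Fintype α] [Fintype β] (Nb : β → Finset α)
    {s : ℕ} {fug η : ℝ} (hfug : 1 ≤ fug) (hs : 64 ≤ s) (hη0 : 0 ≤ η) (hη1 : η ≤ 1)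
    (hη : 64 * Fintype.card β ≤ η * (Fintype.card α * s)) {A : Finset (α ⊕ β)}
    (hA : (bipartiteOf Nb).IsIndepSet (A : Set (α ⊕ β))) (hα : 0 < Fintype.card α)
    (hfree : Fintype.card α ≤ 8 * (Finset.univ.filter fun i : α =>
      i ∉ A.toLeft ∧ ∀ x ∈ A.toRight, i ∉ Nb x).card) :
    lumpedStep (bipartiteOf Nb) (cliqueSizes α β s) fug
      (fun A => Real.exp (A.toRight.card - η * A.toLeft.card)) A ≤
      Real.exp (A.toRight.card - η * A.toLeft.card) := by
  have hs' : (64 : ℝ) ≤ s := by exact_mod_cast hs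
  have hinv : fug⁻¹ ≤ 1 := inv_le_one_of_one_le₀ hfug
  have hinv0 : 0 ≤ fug⁻¹ := by positivity
  set Φ := Real.exp (A.toRight.card - η * A.toLeft.card) with hΦ
  have hΦ0 : 0 ≤ Φ := (Real.exp_pos _).le
  have hexp1 : Real.exp η ≤ 1 + 2 * η := by
    have h := Real.abs_exp_sub_one_le (x := η) (by rwa [abs_of_nonneg hη0])
    rw [abs_of_nonneg hη0] at h
    linarith [le_abs_self (Real.exp η - 1)]
  have hexp2 : Real.exp (-η) ≤ 1 - η / 2 := by
    rw [Real.exp_neg, inv_le_comm₀ (Real.exp_pos _) (by linarith)]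
    refine le_trans ?_ (Real.add_one_le_exp η)
    rw [inv_le_comm₀ (by linarith) (by linarith), inv_eq_one_div, div_le_iff₀ (by linarith)]
    nlinarith
  have hexp3 : Real.exp 1 ≤ 3 := by linarith [Real.exp_one_lt_d9]
  set F := Finset.univ.filter fun i : α => i ∉ A.toLeft ∧ ∀ x ∈ A.toRight, i ∉ Nb x with hF
  have hF' : (Fintype.card α : ℝ) ≤ 8 * F.card := by exact_mod_cast hfree
  have hsum : 0 < ∑ j, cliqueSizes α β s j := by
    rw [sum_cliqueSizes]
    positivity
  have hmem : ∀ i, Sum.inl i ∉ A → (((insert (Sum.inl i) A).toLeft.card : ℕ) : ℝ) =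
    A.toLeft.card + 1 := by
    intro i hi
    rw [Finset.toLeft_insert_inl, Finset.card_insert_of_notMem (by simpa using hi)]
    push_cast; rfl
  have hmem' : ∀ x, Sum.inr x ∉ A → (((insert (Sum.inr x) A).toRight.card : ℕ) : ℝ) =
    A.toRight.card + 1 := by
    intro i hi
    rw [Finset.toRight_insert_inr, Finset.card_insert_of_notMem (by simpa using hi)]
    push_cast; rfl
  have her : ∀ i, Sum.inl i ∈ A → ((A.erase (Sum.inl i)).toLeft.card : ℝ) + 1 = A.toLeft.card ∧
      (A.erase (Sum.inl i)).toRight = A.toRight := by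
    intro i hi
    constructor
    · have e : (A.erase (Sum.inl i)).toLeft = A.toLeft.erase i := by ext j; simp
      rw [e]
      exact_mod_cast Finset.card_erase_add_one (Finset.mem_toLeft.2 hi)
    · ext j; simp
  have her' : ∀ x, Sum.inr x ∈ A → (A.erase (Sum.inr x)).toRight.card ≤ A.toRight.card ∧
      (A.erase (Sum.inr x)).toLeft = A.toLeft := by
    intro i hi
    constructor
    · exact Finset.card_le_card (Finset.toRight_subset_toRight (Finset.erase_subset _ _))
    · ext j; simp
  rw [lumpedStep_eq_sum_lumpedTerm, div_le_iff₀ hsum, Fintype.sum_sum_type]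
  have hleft : ∀ i : α, lumpedTerm (bipartiteOf Nb) (cliqueSizes α β s) fug
      (fun A => Real.exp (A.toRight.card - η * A.toLeft.card)) A (Sum.inl i) ≤
      Φ * (s + 2 * η - if i ∈ F then s * η / 2 else 0) := by
    intro i
    have h3 : 0 ≤ Φ * (2 * η) := by positivity
    by_cases hi : Sum.inl i ∈ A
    · have hiF : i ∉ F := by simp [hF, hi]
      rw [lumpedTerm_of_mem _ _ _ _ hi, if_neg hiF, (her i hi).2, cliqueSizes, Sum.elim_inl, ← hΦ]
      have e : Real.exp (A.toRight.card - η * ((A.erase (Sum.inl i)).toLeft.card : ℝ)) =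
          Φ * Real.exp η := by
        rw [hΦ, ← Real.exp_add, ← (her i hi).1]; congr 1; ring
      rw [e]
      have h1 : Φ * Real.exp η - Φ ≤ Φ * (2 * η) := by
        have := mul_le_mul_of_nonneg_left hexp1 hΦ0
        linarith
      have h2 : fug⁻¹ * (Φ * Real.exp η - Φ) ≤ 1 * (Φ * (2 * η)) := by
        calc _ ≤ fug⁻¹ * (Φ * (2 * η)) := mul_le_mul_of_nonneg_left h1 hinv0
          _ ≤ _ := mul_le_mul_of_nonneg_right hinv h3
      linarith
    · by_cases hI : (bipartiteOf Nb).IsIndepSet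
          ((insert (Sum.inl i) A : Finset (α ⊕ β)) : Set (α ⊕ β))
      · rw [lumpedTerm_of_isIndepSet _ _ _ _ hi hI, hmem i hi, Finset.toRight_insert_inl,
          cliqueSizes, Sum.elim_inl]
        have e : Real.exp (A.toRight.card - η * ((A.toLeft.card : ℝ) + 1)) =
            Φ * Real.exp (-η) := by
          rw [hΦ, ← Real.exp_add]; congr 1; ring
        rw [e]
        have h1 : s * Φ * Real.exp (-η) ≤ s * Φ * (1 - η / 2) :=
          mul_le_mul_of_nonneg_left hexp2 (by positivity)
        have h4 : 0 ≤ s * Φ * (η / 2) := by positivity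
        split_ifs <;> linarith
      · have hiF : i ∉ F := fun h =>
          hI (isIndepSet_insert_inl Nb hA (Finset.mem_filter.1 h).2.2)
        rw [lumpedTerm_of_not_isIndepSet _ _ _ _ hi hI, if_neg hiF, cliqueSizes, Sum.elim_inl, ← hΦ]
        linarith
  have hright : ∀ x : β, lumpedTerm (bipartiteOf Nb) (cliqueSizes α β s) fug
      (fun A => Real.exp (A.toRight.card - η * A.toLeft.card)) A (Sum.inr x) ≤ Φ * 3 := by
    intro x
    by_cases hx : Sum.inr x ∈ A
    · rw [lumpedTerm_of_mem _ _ _ _ hx, (her' x hx).2, cliqueSizes, Sum.elim_inr, ← hΦ]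
      have h1 : Real.exp (((A.erase (Sum.inr x)).toRight.card : ℝ) - η * A.toLeft.card) ≤ Φ := by
        have : ((A.erase (Sum.inr x)).toRight.card : ℝ) ≤ A.toRight.card := by
          exact_mod_cast (her' x hx).1
        exact Real.exp_le_exp.2 (by linarith)
      have h2 := mul_le_mul_of_nonneg_left h1 hinv0
      linarith
    · by_cases hI : (bipartiteOf Nb).IsIndepSet
          ((insert (Sum.inr x) A : Finset (α ⊕ β)) : Set (α ⊕ β))
      · rw [lumpedTerm_of_isIndepSet _ _ _ _ hx hI, hmem' x hx, Finset.toLeft_insert_inr,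
          cliqueSizes, Sum.elim_inr]
        have e : Real.exp ((A.toRight.card : ℝ) + 1 - η * A.toLeft.card) = Φ * Real.exp 1 := by
          rw [hΦ, ← Real.exp_add]; congr 1; ring
        rw [e, one_mul]
        exact mul_le_mul_of_nonneg_left hexp3 hΦ0
      · rw [lumpedTerm_of_not_isIndepSet _ _ _ _ hx hI, cliqueSizes, Sum.elim_inr, ← hΦ]
        linarith
  have hsl : ∑ i : α, ((s : ℝ) + 2 * η - if i ∈ F then s * η / 2 else 0) =
      Fintype.card α * (s + 2 * η) - F.card * (s * η / 2) := by
    rw [Finset.sum_sub_distrib, Finset.sum_const, Finset.card_univ, nsmul_eq_mul,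
      Finset.sum_ite_mem, Finset.univ_inter, Finset.sum_const, nsmul_eq_mul]
  have hl := Finset.sum_le_sum fun i (_ : i ∈ Finset.univ) => hleft i
  have hr := Finset.sum_le_sum fun x (_ : x ∈ Finset.univ) => hright x
  rw [← Finset.mul_sum, hsl] at hl
  rw [Finset.sum_const, Finset.card_univ, nsmul_eq_mul] at hr
  refine (add_le_add hl hr).trans ?_
  have h1 : (Fintype.card α : ℝ) * (s * η) ≤ 8 * F.card * (s * η) :=
    mul_le_mul_of_nonneg_right hF' (by positivity)
  have h2 : (64 : ℝ) * (Fintype.card α * η) ≤ s * (Fintype.card α * η) :=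
    mul_le_mul_of_nonneg_right hs' (by positivity)
  have h3 : (Fintype.card α : ℝ) * (s + 2 * η) - F.card * (s * η / 2) + Fintype.card β * 3 ≤
      Fintype.card α * s + Fintype.card β := by linarith
  have h4 := mul_le_mul_of_nonneg_left h3 hΦ0
  rw [sum_cliqueSizes]
  linarith

theorem lumpedHitting_bipartiteOf_le {α β : Type*} [Fintype α] [Fintype β] (Nb : β → Finset α)
    {s k q₁ q r : ℕ} {fug η : ℝ} (hfug : 1 ≤ fug) (hs : 64 ≤ s) (hη0 : 0 ≤ η) (hη1 : η ≤ 1)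
    (hη : 64 * Fintype.card β ≤ η * (Fintype.card α * s)) (hα : 0 < Fintype.card α)
    (hNb : ∀ x, (Nb x).card ≤ k) (hq₁ : 8 * (q₁ * k) ≤ Fintype.card α) (hq : q₁ < q)
    (hexp : ∀ Q : Finset β, Q.card = q → ∀ W : Finset α, Fintype.card α ≤ 2 * W.card →
      ∃ x ∈ Q, ∃ i ∈ Nb x, i ∈ W)
    (hr : 4 * (q + r) ≤ Fintype.card α) (T : ℕ) :
    lumpedHitting (bipartiteOf Nb) (cliqueSizes α β s) fug {A | A.toRight.card = q} T ∅ ≤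
      Real.exp (-(q₁ + 1 - η * (3 / 4 * Fintype.card α))) +
      (T + 1) * (2 ^ Fintype.card α * (Fintype.card β).choose q / s ^ (q + r)) := by
  classical
  have hf0 : 0 < fug := by linarith
  have hs' : (64 : ℝ) ≤ s := by exact_mod_cast hs
  have hinv : fug⁻¹ ≤ 1 := inv_le_one_of_one_le₀ hfug
  have hc : ∀ j, fug⁻¹ ≤ cliqueSizes α β s j := by
    rintro (i | x)
    · exact hinv.trans (by simp only [cliqueSizes, Sum.elim_inl]; linarith)
    · exact hinv
  have hc0 : ∑ j, cliqueSizes α β s j ≠ 0 := by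
    rw [sum_cliqueSizes]
    positivity
  -- The least exponent `R - η L` when `R ≥ q₁ + 1` and `L ≤ 3/4 |α|`, so the first term of the
  -- bound is at least `1` there.
  set θ : ℝ := q₁ + 1 - η * (3 / 4 * Fintype.card α) with hθ
  set δ : ℝ := 2 ^ Fintype.card α * (Fintype.card β).choose q / s ^ (q + r) with hδ
  have hδ0 : 0 ≤ δ := by positivity
  -- With many occupied cliques the bottleneck bound applies; with more than `q₁` single vertices
  -- the claim is trivial. Only the remaining region needs the drift.
  have hbase : ∀ (T : ℕ) (A : Finset (α ⊕ β)),
      (bipartiteOf Nb).IsIndepSet (A : Set (α ⊕ β)) →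
      (¬ 3 * Fintype.card α ≤ 4 * A.toLeft.card → A.toRight.card ≤ q₁ →
        lumpedHitting (bipartiteOf Nb) (cliqueSizes α β s) fug {A | A.toRight.card = q} T A ≤
        Real.exp (-θ) * Real.exp (A.toRight.card - η * A.toLeft.card) + (T + 1) * δ) →
      lumpedHitting (bipartiteOf Nb) (cliqueSizes α β s) fug {A | A.toRight.card = q} T A ≤
        Real.exp (-θ) * Real.exp (A.toRight.card - η * A.toLeft.card) + (T + 1) * δ := by
    intro T A hA hrest
    have h0 : 0 ≤ Real.exp (-θ) * Real.exp (A.toRight.card - η * A.toLeft.card) := by positivity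
    by_cases hc1 : 3 * Fintype.card α ≤ 4 * A.toLeft.card
    · have h := lumpedHitting_le_of_card_toLeft Nb hfug (by omega : 1 ≤ s) hexp hr T hA hc1 hα
      exact h.trans (by linarith)
    · by_cases hqA : A.toRight.card ≤ q₁
      · exact hrest hc1 hqA
      · refine (lumpedHitting_le_one (bipartiteOf Nb) hf0 hc hc0
          {A : Finset (α ⊕ β) | A.toRight.card = q} T hA).trans ?_
        have h1 : (1 : ℝ) ≤ Real.exp (-θ) * Real.exp (A.toRight.card - η * A.toLeft.card) := by
          rw [← Real.exp_add, Real.one_le_exp_iff]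
          have h2 : (q₁ : ℝ) + 1 ≤ A.toRight.card := by exact_mod_cast not_le.1 hqA
          have h3 : (4 : ℝ) * A.toLeft.card ≤ 3 * Fintype.card α := by
            exact_mod_cast (not_le.1 hc1).le
          have h4 := mul_le_mul_of_nonneg_left h3 hη0
          rw [hθ]
          linarith
        have h2 : 0 ≤ ((T : ℝ) + 1) * δ := by positivity
        linarith
  have key : ∀ (T : ℕ) (A : Finset (α ⊕ β)), (bipartiteOf Nb).IsIndepSet (A : Set (α ⊕ β)) →
      lumpedHitting (bipartiteOf Nb) (cliqueSizes α β s) fug {A | A.toRight.card = q} T A ≤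
      Real.exp (-θ) * Real.exp (A.toRight.card - η * A.toLeft.card) + (T + 1) * δ := by
    intro T
    induction T with
    | zero =>
      intro A hA
      exact hbase 0 A hA fun _ hqA => by
        have : A ∉ {A : Finset (α ⊕ β) | A.toRight.card = q} := fun h : A.toRight.card = q =>
          by omega
        simp only [lumpedHitting, if_neg this]
        positivity
    | succ T ih =>
      intro A hA
      refine hbase (T + 1) A hA fun hc1 hqA => ?_
      have hAB : A ∉ {A : Finset (α ⊕ β) | A.toRight.card = q} := fun h : A.toRight.card = q =>
        by omega
      simp only [lumpedHitting, if_neg hAB]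
      refine (lumpedStep_mono (bipartiteOf Nb) hf0 hc ih hA).trans ?_
      rw [lumpedStep_mul_add_const (bipartiteOf Nb) fug hc0
        (fun A => Real.exp (A.toRight.card - η * A.toLeft.card))]
      -- Less than `3/4` of the cliques are occupied and at most `q₁ * k`, an eighth, are blocked.
      have hfree : Fintype.card α ≤ 8 * (Finset.univ.filter fun i : α =>
          i ∉ A.toLeft ∧ ∀ x ∈ A.toRight, i ∉ Nb x).card := by
        have hcov : (Finset.univ : Finset α) ⊆ (A.toLeft ∪ A.toRight.biUnion Nb) ∪
            Finset.univ.filter fun i : α => i ∉ A.toLeft ∧ ∀ x ∈ A.toRight, i ∉ Nb x := by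
          intro i _
          by_cases h1 : i ∈ A.toLeft
          · simp only [Finset.mem_union, h1, true_or]
          · by_cases h2 : ∃ x ∈ A.toRight, i ∈ Nb x
            · simp only [Finset.mem_union, Finset.mem_biUnion, h2, or_true, true_or]
            · push Not at h2
              exact Finset.mem_union_right _ (Finset.mem_filter.2 ⟨Finset.mem_univ _, h1, h2⟩)
        have h1 := (Finset.card_le_card hcov).trans ((Finset.card_union_le _ _).trans
          (Nat.add_le_add_right (Finset.card_union_le _ _) _))
        have h2 := Finset.card_biUnion_le_card_mul A.toRight Nb k fun x _ => hNb x
        have h3 := Nat.mul_le_mul_right k hqA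
        rw [Finset.card_univ] at h1
        omega
      have hstep := lumpedStep_exp_le Nb hfug hs hη0 hη1 hη hA hα hfree
      have := mul_le_mul_of_nonneg_left hstep (Real.exp_pos (-θ)).le
      push_cast
      linarith
  have h := key T ∅ (by simp [SimpleGraph.IsIndepSet])
  have e1 : (∅ : Finset (α ⊕ β)).toRight = ∅ := rfl
  have e2 : (∅ : Finset (α ⊕ β)).toLeft = ∅ := rfl
  simpa [e1, e2] using h

/-! ### Expanding neighbourhoods -/

/-- A random choice of neighbourhoods of size at most `k` has the property that every set of `q`
vertices has neighbours in every set that contains half of the other side. -/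
theorem exists_expanding_neighbourhoods {m p k q : ℕ} (hm : 0 < m)
    (h : p.choose q * 2 ^ m < 2 ^ (k * q)) :
    ∃ Nb : Fin p → Finset (Fin m), (∀ x, (Nb x).card ≤ k) ∧
      ∀ Q : Finset (Fin p), Q.card = q → ∀ W : Finset (Fin m), m ≤ 2 * W.card →
        ∃ x ∈ Q, ∃ i ∈ Nb x, i ∈ W := by
  classical
  by_contra hcon
  push Not at hcon
  -- Each neighbourhood is the image of `k` free choices; `bad (Q, W)` collects the choices for
  -- which all of `Q` avoids `W`.
  let bad : Finset (Fin p) × Finset (Fin m) → Finset (Fin p → Fin k → Fin m) := fun QW =>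
    Fintype.piFinset fun x => Fintype.piFinset fun _ => if x ∈ QW.1 then QW.2ᶜ else Finset.univ
  let S : Finset (Finset (Fin p) × Finset (Fin m)) :=
    Finset.powersetCard q Finset.univ ×ˢ Finset.univ.filter fun W => m ≤ 2 * W.card
  have hcover : (Finset.univ : Finset (Fin p → Fin k → Fin m)) ⊆ S.biUnion bad := by
    intro F _
    obtain ⟨Q, hQ, W, hW, hno⟩ := hcon (fun x => Finset.univ.image (F x))
      fun x => Finset.card_image_le.trans (by simp)
    refine Finset.mem_biUnion.2 ⟨(Q, W), ?_, ?_⟩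
    · simp [S, Finset.mem_powersetCard, hQ, hW]
    · simp only [bad, Fintype.mem_piFinset]
      intro x l
      split_ifs with hx
      · exact Finset.mem_compl.2 (hno x hx _ (Finset.mem_image_of_mem _ (Finset.mem_univ l)))
      · exact Finset.mem_univ _
  -- Each of the `k * q` choices made by `Q` avoids `W` with probability at most `1/2`; a union
  -- bound over `S` follows.
  have hcard : ∀ QW ∈ S, 2 ^ (k * q) * (bad QW).card ≤ m ^ (k * p) := by
    rintro ⟨Q, W⟩ hQW
    obtain ⟨hQ, hW⟩ := Finset.mem_product.1 hQW
    have hQ : Q.card = q := (Finset.mem_powersetCard.1 hQ).2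
    have hW : m ≤ 2 * W.card := (Finset.mem_filter.1 hW).2
    have hqp : q ≤ p := by simpa [hQ] using Finset.card_le_univ Q
    have e : (bad (Q, W)).card = ((m - W.card) ^ k) ^ q * (m ^ k) ^ (p - q) := by
      simp only [bad, Fintype.card_piFinset, Finset.prod_const, Finset.card_univ, Fintype.card_fin]
      rw [← Finset.prod_mul_prod_compl Q]
      have e1 : ∀ x ∈ Q, (if x ∈ Q then Wᶜ else Finset.univ).card ^ k = (m - W.card) ^ k := by
        intro x hx; rw [if_pos hx, Finset.card_compl, Fintype.card_fin]
      have e2 : ∀ x ∈ Qᶜ, (if x ∈ Q then Wᶜ else Finset.univ).card ^ k = m ^ k := by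
        intro x hx; rw [if_neg (Finset.mem_compl.1 hx), Finset.card_univ, Fintype.card_fin]
      rw [Finset.prod_congr rfl e1, Finset.prod_congr rfl e2, Finset.prod_const, Finset.prod_const,
        Finset.card_compl, Fintype.card_fin, hQ]
    rw [e, ← mul_assoc, ← pow_mul, ← mul_pow, ← pow_mul]
    calc (2 * (m - W.card)) ^ (k * q) * m ^ (k * (p - q)) ≤ m ^ (k * q) * m ^ (k * (p - q)) := by
          gcongr
          omega
      _ = m ^ (k * p) := by rw [← pow_add, ← mul_add, Nat.add_sub_cancel' hqp]
  have hS : S.card ≤ p.choose q * 2 ^ m := by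
    rw [Finset.card_product, Finset.card_powersetCard, Finset.card_univ, Fintype.card_fin]
    refine Nat.mul_le_mul_left _ ((Finset.card_filter_le _ _).trans ?_)
    simp
  have h1 : m ^ (k * p) ≤ ∑ QW ∈ S, (bad QW).card := by
    have := (Finset.card_le_card hcover).trans Finset.card_biUnion_le
    simpa [← pow_mul] using this
  have h2 : 2 ^ (k * q) * m ^ (k * p) ≤ S.card * m ^ (k * p) := by
    calc _ ≤ 2 ^ (k * q) * ∑ QW ∈ S, (bad QW).card := Nat.mul_le_mul_left _ h1
      _ = ∑ QW ∈ S, 2 ^ (k * q) * (bad QW).card := Finset.mul_sum _ _ _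
      _ ≤ _ := by
        rw [← smul_eq_mul]
        exact Finset.sum_le_card_nsmul _ _ _ hcard
  have h3 := Nat.le_of_mul_le_mul_right h2 (by positivity)
  omega

/-! ### Size, edges and independence number of the blow-up -/

/-- The map to the index set of the cliques: `Fin m` indexes cliques of size `s`, `Fin p` indexes
single vertices. -/
def cliqueIndex {V : Type*} {m s p : ℕ} (e : V ≃ (Fin m × Fin s) ⊕ Fin p) (v : V) :
    Fin m ⊕ Fin p :=
  (e v).map Prod.fst id

theorem sum_comp_cliqueIndex {V M : Type*} [Fintype V] [AddCommMonoid M] {m s p : ℕ}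
    (e : V ≃ (Fin m × Fin s) ⊕ Fin p) (g : Fin m ⊕ Fin p → M) :
    ∑ v, g (cliqueIndex e v) = ∑ i, s • g (Sum.inl i) + ∑ x, g (Sum.inr x) := by
  simp only [cliqueIndex]
  rw [e.sum_comp fun w => g (w.map Prod.fst id), Fintype.sum_sum_type, Fintype.sum_prod_type]
  simp

theorem card_filter_cliqueIndex {V : Type*} [Fintype V] {m s p : ℕ}
    (e : V ≃ (Fin m × Fin s) ⊕ Fin p) (j : Fin m ⊕ Fin p) :
    cliqueSizes (Fin m) (Fin p) s j =
      ((Finset.univ.filter fun v => cliqueIndex e v = j).card : ℝ) := by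
  rw [Finset.card_filter, sum_comp_cliqueIndex e fun i => if i = j then 1 else 0]
  rcases j with i | x <;> simp [cliqueSizes]

open Classical in
theorem two_mul_ncard_edgeSet {V : Type*} [Fintype V] (G : SimpleGraph V) :
    2 * G.edgeSet.ncard = ∑ v, ∑ w, if G.Adj v w then 1 else 0 := by
  rw [← SimpleGraph.coe_edgeFinset, Set.ncard_coe_finset, ← G.sum_degrees_eq_twice_card_edges]
  refine Finset.sum_congr rfl fun v _ => ?_
  rw [← Finset.card_filter, ← SimpleGraph.card_neighborFinset_eq_degree]
  congr 1
  ext w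
  simp

theorem two_mul_ncard_edgeSet_blowUp_le {V : Type*} [Fintype V] {m s p k : ℕ}
    (e : V ≃ (Fin m × Fin s) ⊕ Fin p) {Nb : Fin p → Finset (Fin m)} (hNb : ∀ x, (Nb x).card ≤ k) :
    2 * ((bipartiteOf Nb).blowUp (cliqueIndex e)).edgeSet.ncard ≤
      m * s * s + p + 2 * (p * k * s) := by
  classical
  rw [two_mul_ncard_edgeSet]
  -- An overcount that includes the diagonal pairs `v = w` but depends only on the clique indices.
  let f : Fin m ⊕ Fin p → Fin m ⊕ Fin p → ℕ := fun j j' =>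
    (if j = j' then 1 else 0) + (if (bipartiteOf Nb).Adj j j' then 1 else 0)
  have h1 : ∀ v w, (if ((bipartiteOf Nb).blowUp (cliqueIndex e)).Adj v w then 1 else 0) ≤
      f (cliqueIndex e v) (cliqueIndex e w) := by
    intro v w
    by_cases h : ((bipartiteOf Nb).blowUp (cliqueIndex e)).Adj v w
    · rw [if_pos h]
      rcases h.2 with h | h <;> simp [f, h]
    · simp [h]
  refine (Finset.sum_le_sum fun v _ => Finset.sum_le_sum fun w _ => h1 v w).trans ?_
  have h4 : ∀ j, ∑ w, f j (cliqueIndex e w) = ∑ i, s • f j (Sum.inl i) + ∑ x, f j (Sum.inr x) :=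
    fun j => sum_comp_cliqueIndex e (f j)
  simp only [h4]
  rw [sum_comp_cliqueIndex e fun j => ∑ i, s • f j (Sum.inl i) + ∑ x, f j (Sum.inr x)]
  have h2 : ∑ i : Fin m, ∑ x : Fin p, (if i ∈ Nb x then 1 else 0) ≤ p * k := by
    rw [Finset.sum_comm]
    refine (Finset.sum_le_card_nsmul _ _ k fun x _ => ?_).trans (by simp)
    simpa using hNb x
  have h5 : ∑ x : Fin p, ∑ i : Fin m, (if i ∈ Nb x then 1 else 0) ≤ p * k := by
    rwa [Finset.sum_comm] at h2
  have h6 := Nat.mul_le_mul_left s (add_le_add h2 h5)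
  have hll : ∀ i j, f (Sum.inl i) (Sum.inl j) = if i = j then 1 else 0 := by
    intro i j; simp [f, bipartiteOf]
  have hrr : ∀ x y, f (Sum.inr x) (Sum.inr y) = if x = y then 1 else 0 := by
    intro x y; simp [f, bipartiteOf]
  have hlr : ∀ i x, f (Sum.inl i) (Sum.inr x) = if i ∈ Nb x then 1 else 0 := by
    intro i x; by_cases h : i ∈ Nb x <;> simp [f, bipartiteOf, h]
  have hrl : ∀ x i, f (Sum.inr x) (Sum.inl i) = if i ∈ Nb x then 1 else 0 := by
    intro x i; by_cases h : i ∈ Nb x <;> simp [f, bipartiteOf, h]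
  simp only [hll, hrr, hlr, hrl, Finset.sum_add_distrib, smul_eq_mul, ← Finset.mul_sum,
    Finset.sum_ite_eq, Finset.mem_univ, if_true, Finset.sum_const, Finset.card_univ,
    Fintype.card_fin, mul_one]
  linarith

/-- The edges inside the `m` cliques suffice; the correction `m * s + p` accounts for the diagonal
pairs. -/
theorem le_two_mul_ncard_edgeSet_blowUp {V : Type*} [Fintype V] {m s p : ℕ}
    (e : V ≃ (Fin m × Fin s) ⊕ Fin p) (H : SimpleGraph (Fin m ⊕ Fin p)) :
    m * s * s ≤ 2 * (H.blowUp (cliqueIndex e)).edgeSet.ncard + (m * s + p) := by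
  classical
  rw [two_mul_ncard_edgeSet]
  have h1 : ∀ v w, (if cliqueIndex e v = cliqueIndex e w then 1 else 0) ≤
      (if (H.blowUp (cliqueIndex e)).Adj v w then 1 else 0) + if v = w then 1 else 0 := by
    intro v w
    by_cases h : v = w
    · simp [h]
    · by_cases h' : cliqueIndex e v = cliqueIndex e w
      · simp [SimpleGraph.blowUp, h, h']
      · simp [h']
  have h2 := Finset.sum_le_sum fun v (_ : v ∈ Finset.univ) =>
    Finset.sum_le_sum fun w (_ : w ∈ Finset.univ) => h1 v w
  simp only [Finset.sum_add_distrib] at h2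
  have h3 : ∑ v : V, ∑ w : V, (if v = w then 1 else 0) = m * s + p := by
    simp [Fintype.card_congr e]
  rw [h3] at h2
  refine le_trans ?_ h2
  have h4 : ∀ j, ∑ w, (if j = cliqueIndex e w then 1 else 0) =
      ∑ i, s • (if j = Sum.inl i then 1 else 0) + ∑ x, (if j = Sum.inr x then 1 else 0) :=
    fun j => sum_comp_cliqueIndex e fun j' => if j = j' then 1 else 0
  simp only [h4]
  rw [sum_comp_cliqueIndex e fun j => ∑ i, s • (if j = Sum.inl i then 1 else 0) +
    ∑ x, (if j = Sum.inr x then 1 else 0)]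
  simp [mul_assoc]

theorem le_indepNum_blowUp {V : Type*} [Fintype V] {m s p : ℕ}
    (e : V ≃ (Fin m × Fin s) ⊕ Fin p) (Nb : Fin p → Finset (Fin m)) :
    p ≤ ((bipartiteOf Nb).blowUp (cliqueIndex e)).indepNum := by
  classical
  let I : Finset V := Finset.univ.map ⟨fun x : Fin p => e.symm (Sum.inr x),
    fun x y h => Sum.inr_injective (e.symm.injective h)⟩
  have hI : ((bipartiteOf Nb).blowUp (cliqueIndex e)).IsIndepSet (I : Set V) := by
    intro v hv w hw hne hadj
    obtain ⟨x, -, rfl⟩ := Finset.mem_map.1 (Finset.mem_coe.1 hv)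
    obtain ⟨y, -, rfl⟩ := Finset.mem_map.1 (Finset.mem_coe.1 hw)
    have hc : ∀ x, cliqueIndex e (e.symm (Sum.inr x)) = Sum.inr x := fun x => by simp [cliqueIndex]
    have h : cliqueIndex e (e.symm (Sum.inr x)) = cliqueIndex e (e.symm (Sum.inr y)) ∨
      (bipartiteOf Nb).Adj (cliqueIndex e (e.symm (Sum.inr x)))
        (cliqueIndex e (e.symm (Sum.inr y))) := hadj.2
    rw [hc, hc] at h
    rcases h with h | h
    · exact hne (by rw [Sum.inr_injective h])
    · exact h
  have := hI.card_le_indepNum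
  simpa [I] using this

theorem indepNum_blowUp_le {V J : Type*} [Fintype V] [Fintype J] (H : SimpleGraph J) (π : V → J) :
    (H.blowUp π).indepNum ≤ Fintype.card J := by
  obtain ⟨I, hI⟩ := (H.blowUp π).exists_isNIndepSet_indepNum
  rw [← hI.card_eq, ← Finset.card_univ]
  exact Finset.card_le_card_of_injOn π (fun _ _ => Finset.mem_coe.2 (Finset.mem_univ _))
    ((H.isIndepSet_blowUp_iff π I).1 hI.isIndepSet).1

/-! ### From large independent sets to hitting events -/

theorem isIndepSet_metropolisProcess {V : Type*} [DecidableEq V] (G : SimpleGraph V) (fug : ℝ)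
    (ω : ℕ → V × unitInterval) (t : ℕ) :
    G.IsIndepSet (metropolisProcess G fug ω t : Set V) := by
  induction t with
  | zero => simp [metropolisProcess, SimpleGraph.IsIndepSet]
  | succ t ih => exact isIndepSet_metropolisUpdate G fug ih _ _

theorem metropolisUpdate_subset_insert {V : Type*} [DecidableEq V] (G : SimpleGraph V) (fug : ℝ)
    (I : Finset V) (v : V) (ζ : unitInterval) : metropolisUpdate G fug I v ζ ⊆ insert v I := by
  unfold metropolisUpdate
  split_ifs
  · exact (Finset.erase_subset _ _).trans (Finset.subset_insert _ _)
  · exact Finset.subset_insert _ _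
  · exact Finset.Subset.refl _
  · exact Finset.subset_insert _ _

/-- The count starts at `0` and rises by at most one per step, so it skips no value. -/
theorem exists_card_toRight_eq {V α β : Type*} [DecidableEq V] [DecidableEq α] [DecidableEq β]
    (G : SimpleGraph V) (fug : ℝ) (π : V → α ⊕ β) (ω : ℕ → V × unitInterval) {q t : ℕ}
    (h : q ≤ ((metropolisProcess G fug ω t).image π).toRight.card) :
    ∃ t' ≤ t, ((metropolisProcess G fug ω t').image π).toRight.card = q := by
  classical
  induction t with
  | zero =>
    refine ⟨0, le_rfl, le_antisymm ?_ h⟩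
    have e : (∅ : Finset (α ⊕ β)).toRight = ∅ := rfl
    simp [metropolisProcess, e]
  | succ t ih =>
    by_cases hq : q ≤ ((metropolisProcess G fug ω t).image π).toRight.card
    · obtain ⟨t', ht', e⟩ := ih hq
      exact ⟨t', ht'.trans t.le_succ, e⟩
    · refine ⟨t + 1, le_rfl, le_antisymm ?_ h⟩
      have hsub := Finset.image_subset_image (f := π)
        (metropolisUpdate_subset_insert G fug (metropolisProcess G fug ω t) (ω t).1 (ω t).2)
      rw [Finset.image_insert] at hsub
      have h1 := Finset.card_le_card (Finset.toRight_subset_toRight hsub)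
      have h2 : (insert (π (ω t).1) ((metropolisProcess G fug ω t).image π)).toRight.card ≤
          ((metropolisProcess G fug ω t).image π).toRight.card + 1 := by
        rcases π (ω t).1 with i | x
        · rw [Finset.toRight_insert_inl]; omega
        · rw [Finset.toRight_insert_inr]; exact Finset.card_insert_le _ _
      change (Finset.image π (metropolisUpdate G fug _ _ _)).toRight.card ≤ q
      omega

/-- The `m` cliques carry at most one vertex each, so at least `q` of the `m + q` vertices are
single ones. -/
theorem exists_card_toRight_eq_of_le_card {V : Type*} [DecidableEq V] {m p : ℕ}
    (H : SimpleGraph (Fin m ⊕ Fin p)) (π : V → Fin m ⊕ Fin p) (fug : ℝ)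
    (ω : ℕ → V × unitInterval) {q t : ℕ}
    (h : m + q ≤ (metropolisProcess (H.blowUp π) fug ω t).card) :
    ∃ t' ≤ t, ((metropolisProcess (H.blowUp π) fug ω t').image π).toRight.card = q := by
  refine exists_card_toRight_eq _ fug π ω ?_
  have hinj := ((H.isIndepSet_blowUp_iff π _).1
    (isIndepSet_metropolisProcess (H.blowUp π) fug ω t)).1
  rw [← Finset.card_image_of_injOn hinj, ← Finset.card_toLeft_add_card_toRight] at h
  have h1 := Finset.card_le_univ ((metropolisProcess (H.blowUp π) fug ω t).image π).toLeft
  rw [Fintype.card_fin] at h1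
  omega

/-! ### Numerical estimates -/

theorem choose_le_exp_mul_div_pow (p q : ℕ) : (p.choose q : ℝ) * q ^ q ≤ (Real.exp 1 * p) ^ q := by
  have h1 : (p.choose q : ℝ) ≤ (p : ℝ) ^ q / q.factorial := Nat.choose_le_pow_div q p
  have h2 := Real.pow_div_factorial_le_exp (q : ℝ) (Nat.cast_nonneg q) q
  have h3 : Real.exp q = Real.exp 1 ^ q := by rw [← Real.exp_nat_mul, mul_one]
  rw [h3] at h2
  calc (p.choose q : ℝ) * q ^ q ≤ (p : ℝ) ^ q / q.factorial * q ^ q := by gcongr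
    _ = p ^ q * ((q : ℝ) ^ q / q.factorial) := by ring
    _ ≤ p ^ q * Real.exp 1 ^ q := by gcongr
    _ = _ := by rw [mul_pow, mul_comm]

theorem choose_le_pow_of_exp_mul_le {p q : ℕ} {d : ℝ} (hq : 0 < q) (h : Real.exp 1 * p ≤ q * d) :
    (p.choose q : ℝ) ≤ d ^ q := by
  have hq' : (0 : ℝ) < (q : ℝ) ^ q := by positivity
  refine le_of_mul_le_mul_right ?_ hq'
  calc (p.choose q : ℝ) * q ^ q ≤ (Real.exp 1 * p) ^ q := choose_le_exp_mul_div_pow p q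
    _ ≤ (q * d) ^ q := by gcongr
    _ = _ := by rw [mul_pow, mul_comm]

/-- The binomial coefficient is at most `exp (k * q / 3)` and `2 ^ m` at most `2 ^ (k * q / 3)`; the
inequality then comes down to `log 2 > 1/2`. -/
theorem choose_mul_two_pow_lt {p q k m : ℕ} {d : ℝ} (hd : 0 < d) (hq : 0 < q) (hk : 0 < k)
    (hkd : 3 * Real.log d ≤ k) (hm : 3 * m ≤ k * q) (hp : Real.exp 1 * p ≤ q * d) :
    p.choose q * 2 ^ m < 2 ^ (k * q) := by
  have h1 := choose_le_pow_of_exp_mul_le hq hp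
  have h2 : (2 : ℝ) = Real.exp (Real.log 2) := (Real.exp_log two_pos).symm
  have h3 : d ^ q = Real.exp (q * Real.log d) := by rw [Real.exp_nat_mul, Real.exp_log hd]
  have h4 : ∀ j : ℕ, (2 : ℝ) ^ j = Real.exp (j * Real.log 2) := fun j => by
    rw [Real.exp_nat_mul, Real.exp_log two_pos]
  have h5 : (p.choose q : ℝ) * 2 ^ m < 2 ^ (k * q) := by
    refine (mul_le_mul_of_nonneg_right h1 (by positivity)).trans_lt ?_
    rw [h3, h4, h4, ← Real.exp_add, Real.exp_lt_exp]
    have hlog := Real.log_two_gt_d9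
    have hm' : (3 : ℝ) * m ≤ k * q := by exact_mod_cast hm
    have h6 : (3 : ℝ) * m * Real.log 2 ≤ k * q * Real.log 2 :=
      mul_le_mul_of_nonneg_right hm' (by positivity)
    have h7 : q * (3 * Real.log d) ≤ q * (k : ℝ) :=
      mul_le_mul_of_nonneg_left hkd (Nat.cast_nonneg q)
    have h8 : (0 : ℝ) < k * q := by positivity
    have h9 : (k : ℝ) * q * (1 / 2) < k * q * Real.log 2 :=
      mul_lt_mul_of_pos_left (by linarith) h8
    push_cast
    nlinarith
  exact_mod_cast h5

/-- In the blow-up of a suitable bipartite graph, the Metropolis process with any fugacity fails to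
find an independent set much larger than the number `m` of cliques. -/
theorem measureReal_metropolisProcess_bipartiteOf_le {V : Type*} [Fintype V] [Nonempty V]
    [DecidableEq V] [MeasurableSpace V] [MeasurableSingletonClass V] {m s p k q₁ q r : ℕ}
    (e : V ≃ (Fin m × Fin s) ⊕ Fin p) (Nb : Fin p → Finset (Fin m))
    {fug : ℝ} (hfug : 1 ≤ fug) (hs : 64 ≤ s) (hp : 64 * p ≤ m * s) (hm : 0 < m)
    (hNb : ∀ x, (Nb x).card ≤ k) (hq₁ : 8 * (q₁ * k) ≤ m) (hq : q₁ < q)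
    (hexp : ∀ Q : Finset (Fin p), Q.card = q → ∀ W : Finset (Fin m), m ≤ 2 * W.card →
      ∃ x ∈ Q, ∃ i ∈ Nb x, i ∈ W)
    (hr : 4 * (q + r) ≤ m) (T : ℕ) :
    (metropolisMeasure V).real {ω | ∃ t ≤ T, m + q ≤
      (metropolisProcess ((bipartiteOf Nb).blowUp (cliqueIndex e)) fug ω t).card} ≤
      Real.exp (-(q₁ + 1 - 48 * p / s)) + (T + 1) * (2 ^ m * p.choose q / s ^ (q + r)) := by
  have hs0 : (0 : ℝ) < s := by exact_mod_cast (by omega : 0 < s)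
  have hm0 : (0 : ℝ) < m := by exact_mod_cast hm
  have hms : (0 : ℝ) < m * s := by positivity
  have hp' : (64 : ℝ) * p ≤ m * s := by exact_mod_cast hp
  have h := lumpedHitting_bipartiteOf_le Nb (s := s) (k := k) (q₁ := q₁) (q := q) (r := r)
    -- The smallest `η` that the drift estimate allows; it turns `η * (3/4 * m)` into `48 * p / s`.
    (η := 64 * p / (m * s)) hfug hs (by positivity) ((div_le_one hms).2 hp')
    (by simp only [Fintype.card_fin]; rw [div_mul_cancel₀ _ hms.ne']) (by simpa using hm) hNb
    (by simpa using hq₁) hq (by simpa using hexp) (by simpa using hr) T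
  have h2 := measureReal_metropolisProcess_blowUp_le (bipartiteOf Nb) (cliqueIndex e)
    (card_filter_cliqueIndex e) hfug {A | A.toRight.card = q} T
  simp only [Fintype.card_fin] at h
  have e1 : (64 * p / (m * s) : ℝ) * (3 / 4 * m) = 48 * p / s := by
    field_simp
    ring
  rw [e1] at h
  have : IsProbabilityMeasure (metropolisMeasure V) := by
    unfold metropolisMeasure; infer_instance
  refine le_trans (measureReal_mono ?_) (h2.trans h)
  rintro ω ⟨t, ht, hcard⟩
  obtain ⟨t', ht', hc⟩ := exists_card_toRight_eq_of_le_card _ _ fug ω hcard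
  exact ⟨t', ht'.trans ht, hc⟩

/-- Since `choose ≤ d ^ q`, the factor `s ^ (q + r)` leaves `d ^ r ≥ exp (48 * r) ≥ exp (3 * m)`,
which beats `2 ^ m` and the `exp (m / 2)` steps. Both terms are then at most `exp (-x - 1)`, and `2
< exp 1`. -/
theorem exp_add_floor_mul_le {m p q r s : ℕ} {d x y z : ℝ} (hd : Real.exp 48 ≤ d) (hs : d ≤ s)
    (hq : 0 < q) (hpq : Real.exp 1 * p ≤ q * d) (hr : m ≤ 16 * r) (hx : 1 ≤ x) (hxm : x + 2 ≤ m)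
    (hy : y ≤ m / 2) (hz : 4 * x ≤ z) :
    Real.exp (-z) + ((⌊Real.exp y⌋₊ : ℝ) + 1) * (2 ^ m * p.choose q / s ^ (q + r)) ≤
      Real.exp (-x) := by
  have hd0 : 0 < d := (Real.exp_pos _).trans_le hd
  have he1 := Real.exp_one_gt_d9
  have hs0 : (0 : ℝ) < s := hd0.trans_le hs
  have h1 : Real.exp (-z) ≤ Real.exp (-x - 1) := Real.exp_le_exp.2 (by linarith)
  have h2 : (2 : ℝ) ^ m * p.choose q / s ^ (q + r) ≤ Real.exp (-(2 * m)) := by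
    have hc := choose_le_pow_of_exp_mul_le hq hpq
    rw [div_le_iff₀ (by positivity)]
    have ha : (2 : ℝ) ^ m ≤ Real.exp m := by
      rw [← mul_one (m : ℝ), Real.exp_nat_mul]
      exact pow_le_pow_left₀ (by norm_num) (by linarith) m
    have hb : Real.exp (3 * m) ≤ d ^ r := by
      have hr' : (m : ℝ) ≤ 16 * r := by exact_mod_cast hr
      calc Real.exp (3 * m) ≤ Real.exp (r * 48) := Real.exp_le_exp.2 (by linarith)
        _ = Real.exp 48 ^ r := Real.exp_nat_mul _ _
        _ ≤ d ^ r := by gcongr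
    calc (2 : ℝ) ^ m * p.choose q ≤ Real.exp m * d ^ q := by gcongr
      _ = Real.exp (-(2 * m)) * (d ^ q * Real.exp (3 * m)) := by
        rw [mul_left_comm, ← Real.exp_add, mul_comm]; congr 2; ring
      _ ≤ Real.exp (-(2 * m)) * (d ^ q * d ^ r) := by gcongr
      _ = Real.exp (-(2 * m)) * d ^ (q + r) := by rw [pow_add]
      _ ≤ Real.exp (-(2 * m)) * s ^ (q + r) := by gcongr
  have h3 : (⌊Real.exp y⌋₊ : ℝ) + 1 ≤ Real.exp (1 + m / 2) := by
    have hb := Nat.floor_le (Real.exp_pos y).le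
    have hc := Real.exp_le_exp.2 hy
    have hd1 : 1 ≤ Real.exp ((m : ℝ) / 2) := Real.one_le_exp (by positivity)
    have he : 2 * Real.exp ((m : ℝ) / 2) ≤ Real.exp 1 * Real.exp (m / 2) :=
      mul_le_mul_of_nonneg_right (by linarith) (Real.exp_pos _).le
    rw [Real.exp_add]
    linarith
  have h4 : ((⌊Real.exp y⌋₊ : ℝ) + 1) * (2 ^ m * p.choose q / s ^ (q + r)) ≤
      Real.exp (-x - 1) := by
    calc _ ≤ Real.exp (1 + m / 2) * Real.exp (-(2 * m)) := by gcongr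
      _ = Real.exp (1 + m / 2 + -(2 * m)) := (Real.exp_add _ _).symm
      _ ≤ _ := Real.exp_le_exp.2 (by linarith)
  have h5 : 2 * Real.exp (-x - 1) ≤ Real.exp (-x) := by
    have : Real.exp (-x) = Real.exp 1 * Real.exp (-x - 1) := by
      rw [← Real.exp_add]; congr 1; ring
    rw [this]
    exact mul_le_mul_of_nonneg_right (by linarith) (Real.exp_pos _).le
  linarith

/-! ### Choice of parameters and conclusion -/

theorem exists_graph_metropolisProcess_fails (n : ℕ) {d : ℝ} (hd : Real.exp 48 ≤ d)
    (hn : d * Real.log d ≤ n) :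
    ∃ (N : ℕ) (_ : NeZero N) (G : SimpleGraph (Fin N)),
      (1 / 4 * n ≤ (N : ℝ) ∧ (N : ℝ) ≤ 10000 * n) ∧
      (1 / 4 * d ≤ averageDegree G ∧ averageDegree G ≤ 10000 * d) ∧
      (1 / 4 * (n / Real.log d) ≤ (G.indepNum : ℝ) ∧
        (G.indepNum : ℝ) ≤ 10000 * (n / Real.log d)) ∧
      ∀ fug : ℝ, 1 ≤ fug →
        (metropolisMeasure (Fin N)).real
          {ω | ∃ t : ℕ, (t : ℝ) ≤ Real.exp (n / (10000 * d)) ∧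
            10000 * (Real.log d / d) * (G.indepNum : ℝ) ≤
              ((metropolisProcess G fug ω t).card : ℝ)}
          ≤ Real.exp (-(n / (d * Real.log d))) := by
  have hd0 : 0 < d := (Real.exp_pos _).trans_le hd
  set L := Real.log d with hL
  have hL48 : 48 ≤ L := (Real.le_log_iff_exp_le hd0).2 hd
  have hLd : L ≤ d := (Real.log_le_self hd0.le)
  have hd64 : 64 ≤ d := by
    have h1 : (2 : ℝ) ^ 48 ≤ Real.exp 48 := by
      have h2 : (2 : ℝ) ≤ Real.exp 1 := by linarith [Real.exp_one_gt_d9]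
      have h3 : Real.exp 48 = Real.exp 1 ^ 48 := by rw [← Real.exp_nat_mul]; norm_num
      rw [h3]
      exact pow_le_pow_left₀ (by norm_num) h2 48
    have h2 : (64 : ℝ) ≤ 2 ^ 48 := by norm_num
    linarith
  have hL0 : 0 < L := by linarith
  -- The exponent of the required failure probability and the natural unit: `n / d = x * L` and `n /
  -- L = x * d`.
  set x : ℝ := n / (d * L) with hx
  have hx1 : 1 ≤ x := by rwa [hx, one_le_div (by positivity)]
  have hnd : (n : ℝ) / d = x * L := by rw [hx]; field_simp
  have hnL : (n : ℝ) / L = x * d := by rw [hx]; field_simp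
  have hnx : (n : ℝ) = x * d * L := by rw [hx]; field_simp
  set s := ⌈d⌉₊ with hs
  set m := ⌈3200 * (x * L)⌉₊ with hm
  set p := ⌈x * d⌉₊ with hp
  set k := ⌈3 * L⌉₊ with hk
  have hs1 : d ≤ s := Nat.le_ceil d
  have hs2 : (s : ℝ) ≤ d + 1 := (Nat.ceil_lt_add_one hd0.le).le
  have hm1 : 3200 * (x * L) ≤ m := Nat.le_ceil _
  have hxL : 48 ≤ x * L := by nlinarith
  have hxd : 64 ≤ x * d := by nlinarith
  have hm2 : (m : ℝ) ≤ 3200 * (x * L) + 1 := (Nat.ceil_lt_add_one (by positivity)).le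
  have hp1 : x * d ≤ p := Nat.le_ceil _
  have hp2 : (p : ℝ) ≤ 2 * (x * d) := by linarith [Nat.ceil_lt_add_one (show 0 ≤
    x * d by positivity)]
  have hk1 : 3 * L ≤ k := Nat.le_ceil _
  have hk2 : (k : ℝ) ≤ 4 * L := by linarith [Nat.ceil_lt_add_one (show 0 ≤ 3 * L by positivity)]
  have hkN : 48 ≤ k := by
    have : (48 : ℝ) ≤ k := by linarith
    exact_mod_cast this
  have hk0 : (0 : ℝ) < k := by linarith
  have hsN : 64 ≤ s := by
    have : (64 : ℝ) ≤ s := by linarith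
    exact_mod_cast this
  have hmN : 32 ≤ m := by
    have : (32 : ℝ) ≤ m := by linarith
    exact_mod_cast this
  -- `q` is just large enough for the union bound, `q₁` just small enough to block at most `m / 8`
  -- cliques, and `r` leaves `q + r ≤ m / 4`.
  set q := 3 * m / k + 1 with hq
  set q₁ := m / (8 * k) with hq₁
  set r := m / 8 - 1 with hr
  have hx0 : 0 < x := by linarith
  have hkq : 3 * m ≤ k * q := (Nat.lt_mul_div_succ _ (by omega)).le
  have hq₁k : 8 * (q₁ * k) ≤ m := by
    have := Nat.div_mul_le_self m (8 * k)
    rw [← hq₁] at this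
    linarith
  have hq₁q : q₁ < q := Nat.lt_succ_of_le (Nat.div_le_div (by omega) (by omega) (by omega))
  have hqr : 4 * (q + r) ≤ m := by
    have : 3 * m / k ≤ 3 * m / 48 := Nat.div_le_div_left hkN (by norm_num)
    omega
  have hr16 : m ≤ 16 * r := by omega
  -- The constant `3200` in `m` is chosen so that `3200 / 32 = 100` exceeds the `96` of `hps`; the
  -- difference `4 * x` is the exponent used at the end.
  have hq₁x : 100 * x ≤ q₁ + 1 := by
    have h1 : m < 8 * k * (q₁ + 1) := Nat.lt_mul_div_succ _ (by omega)
    have h2 : (m : ℝ) < 8 * k * (q₁ + 1) := by exact_mod_cast h1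
    have h3 : (8 : ℝ) * k * (q₁ + 1) ≤ 8 * (4 * L) * (q₁ + 1) := by gcongr
    refine le_of_mul_le_mul_right ?_ hL0
    linarith
  have hps : 48 * (p : ℝ) / s ≤ 96 * x := by
    rw [div_le_iff₀ (by linarith)]
    have : x * d ≤ x * s := by gcongr
    linarith
  have hqx : 2400 * x ≤ q := by
    have h2 : (3 : ℝ) * m ≤ k * q := by exact_mod_cast hkq
    have h3 : (k : ℝ) * q ≤ 4 * L * q := by gcongr
    refine le_of_mul_le_mul_right ?_ hL0
    linarith
  have hpq : Real.exp 1 * p ≤ q * d := by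
    have h1 : Real.exp 1 ≤ 3 := by linarith [Real.exp_one_lt_d9]
    have h2 : Real.exp 1 * p ≤ 3 * (2 * (x * d)) := by gcongr
    have h3 : 2400 * x * d ≤ q * d := by gcongr
    have h4 : 0 < x * d := by positivity
    linarith
  have hms : 3200 * n ≤ (m : ℝ) * s := by
    calc 3200 * (n : ℝ) = 3200 * (x * L) * d := by rw [hnx]; ring
      _ ≤ m * s := by gcongr
  have hxdn : 48 * (x * d) ≤ n := by
    have : x * d * 48 ≤ x * d * L := by gcongr
    rw [hnx]; linarith
  have hxLn : 64 * (x * L) ≤ n := by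
    have : x * L * 64 ≤ x * L * d := by gcongr
    rw [hnx]; linarith
  have hpN : 64 * p ≤ m * s := by
    have : (64 : ℝ) * p ≤ m * s := by linarith
    exact_mod_cast this
  obtain ⟨Nb, hNb, hexp⟩ := exists_expanding_neighbourhoods (by omega)
    (choose_mul_two_pow_lt hd0 (Nat.succ_pos _) (by omega) hk1 hkq hpq)
  have hN0 : NeZero (m * s + p) := ⟨by positivity⟩
  have e : Fin (m * s + p) ≃ (Fin m × Fin s) ⊕ Fin p :=
    (Fintype.equivFinOfCardEq (by simp)).symm
  refine ⟨m * s + p, hN0, (bipartiteOf Nb).blowUp (cliqueIndex e), ?_, ?_, ?_, ?_⟩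
  · push_cast
    have h1 : (m : ℝ) * s ≤ (3201 * (x * L)) * (2 * d) := by
      gcongr <;> linarith
    have h2 : (3201 * (x * L)) * (2 * d) = 6402 * n := by rw [hnx]; ring
    have h3 : (0 : ℝ) ≤ p := by positivity
    constructor <;> linarith
  · have h1 := two_mul_ncard_edgeSet_blowUp_le e hNb
    have h2 := le_two_mul_ncard_edgeSet_blowUp e (bipartiteOf Nb)
    have h1' : (2 : ℝ) * ((bipartiteOf Nb).blowUp (cliqueIndex e)).edgeSet.ncard ≤
      m * s * s + p + 2 * (p * k * s) := by exact_mod_cast h1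
    have h2' : (m : ℝ) * s * s ≤
        2 * ((bipartiteOf Nb).blowUp (cliqueIndex e)).edgeSet.ncard + (m * s + p) := by
      exact_mod_cast h2
    have hpN' : (64 : ℝ) * p ≤ m * s := by exact_mod_cast hpN
    have hs0 : (0 : ℝ) < s := by linarith
    have hp0 : (0 : ℝ) ≤ p := by positivity
    have hNpos : (0 : ℝ) < m * s + p := by
      have : (0 : ℝ) < m * s := by positivity
      linarith
    simp only [averageDegree, Fintype.card_fin]
    push_cast
    rw [le_div_iff₀ hNpos, div_le_iff₀ hNpos]
    have hmsd : (m : ℝ) * s * d ≤ m * s * s := by gcongr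
    have hmsd2 : (m : ℝ) * s * s ≤ m * s * (2 * d) := by gcongr; linarith
    have hpd : 64 * p * d ≤ m * s * d := by gcongr
    have h64 : (m : ℝ) * s * 64 ≤ m * s * d := by gcongr
    constructor
    · linarith
    · have h3 : (p : ℝ) * k * s ≤ 2 * (x * d) * (4 * L) * s := by gcongr
      have h4 : 3200 * (x * L) * (s * d) ≤ m * (s * d) := by gcongr
      have h5 : 0 ≤ p * d := by positivity
      have h6 : 0 ≤ (m : ℝ) * s * d := by positivity
      linarith
  · have h1 := le_indepNum_blowUp e Nb
    have h2 := indepNum_blowUp_le (bipartiteOf Nb) (cliqueIndex e)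
    simp only [Fintype.card_sum, Fintype.card_fin] at h2
    have h1' : (p : ℝ) ≤ ((bipartiteOf Nb).blowUp (cliqueIndex e)).indepNum := by exact_mod_cast h1
    have h2' : (((bipartiteOf Nb).blowUp (cliqueIndex e)).indepNum : ℝ) ≤ m + p := by
      exact_mod_cast h2
    have h3 : x * L ≤ x * d := by gcongr
    rw [hnL]
    constructor <;> linarith
  · intro fug hfug
    have h := measureReal_metropolisProcess_bipartiteOf_le e Nb hfug hsN hpN (by omega) hNb hq₁k
      hq₁q hexp hqr ⌊Real.exp (n / (10000 * d))⌋₊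
    have hprob : IsProbabilityMeasure (metropolisMeasure (Fin (m * s + p))) := by
      unfold metropolisMeasure; infer_instance
    refine le_trans (measureReal_mono ?_) (h.trans ?_)
    · rintro ω ⟨t, ht, hcard⟩
      refine ⟨t, Nat.le_floor ht, ?_⟩
      have h1 : (p : ℝ) ≤ ((bipartiteOf Nb).blowUp (cliqueIndex e)).indepNum := by
        exact_mod_cast le_indepNum_blowUp e Nb
      have h2 : 10000 * (L / d) * (x * d) ≤
          10000 * (L / d) * ((bipartiteOf Nb).blowUp (cliqueIndex e)).indepNum := by
        gcongr
        linarith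
      have h3 : 10000 * (L / d) * (x * d) = 10000 * (x * L) := by field_simp
      -- As `q ≤ m`, the sum is at most `2 * m ≤ 6400 * (x * L) + 2`.
      have h4 : ((m + q : ℕ) : ℝ) ≤ 10000 * (x * L) := by
        have : q ≤ m := by omega
        have : (q : ℝ) ≤ m := by exact_mod_cast this
        push_cast
        linarith
      have h5 : ((m + q : ℕ) : ℝ) ≤
          ((metropolisProcess ((bipartiteOf Nb).blowUp (cliqueIndex e)) fug ω t).card : ℝ) := by
        linarith
      exact_mod_cast h5
    · have hxx : x * 48 ≤ x * L := by gcongr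
      refine exp_add_floor_mul_le hd hs1 (Nat.succ_pos _) hpq hr16 hx1 ?_ ?_ ?_
      · linarith only [hxx, hm1, hx1]
      · rw [mul_comm, ← div_div, hnd]
        linarith only [hm1, hxL]
      · linarith only [hq₁x, hps, hx1]

/-- Eventually `d n ≤ n / log n ^ 2 ≤ n`, so `log (d n) ≤ log n`, and one of the two logarithms
suffices. -/
theorem eventually_mul_log_le {d : ℕ → ℝ} (hd : ∀ n : ℕ, 1 ≤ n → 1 ≤ d n)
    (h : d =o[atTop] (fun n : ℕ => (n : ℝ) / Real.log (n : ℝ) ^ 2)) :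
    ∀ᶠ n : ℕ in atTop, d n * Real.log (d n) ≤ n := by
  filter_upwards [h.bound one_pos, eventually_ge_atTop 3] with n hn hn3
  have hn3' : (3 : ℝ) ≤ n := by exact_mod_cast hn3
  have hlog : 1 ≤ Real.log n := by
    rw [Real.le_log_iff_exp_le (by linarith)]
    linarith [Real.exp_one_lt_d9]
  have hd1 := hd n (by omega)
  rw [one_mul, Real.norm_of_nonneg (by linarith), Real.norm_of_nonneg (by positivity),
    le_div_iff₀ (by positivity)] at hn
  have h1 : d n * Real.log n ≤ d n * Real.log n ^ 2 := by
    gcongr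
    nlinarith
  have h2 : d n * 1 ≤ d n * Real.log n := by gcongr
  have h3 : Real.log (d n) ≤ Real.log n := Real.log_le_log (by linarith) (by linarith)
  have h4 : d n * Real.log (d n) ≤ d n * Real.log n := by gcongr
  linarith

theorem theorem1p1 :
    ∃ C C' a b : ℝ, 0 < C ∧ 0 < C' ∧ 0 < a ∧ 0 < b ∧
      ∀ d : ℕ → ℝ,
        (∀ n : ℕ, 1 ≤ n → C ≤ d n) →
        d =o[atTop] (fun n : ℕ => (n : ℝ) / Real.log (n : ℝ) ^ 2) →
        ∃ (N : ℕ → ℕ) (_ : ∀ n, NeZero (N n)) (G : ∀ n, SimpleGraph (Fin (N n))),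
          ∀ᶠ n : ℕ in atTop,
            (a * n ≤ (N n : ℝ) ∧ (N n : ℝ) ≤ b * n) ∧
            (a * d n ≤ averageDegree (G n) ∧ averageDegree (G n) ≤ b * d n) ∧
            (a * (n / Real.log (d n)) ≤ ((G n).indepNum : ℝ) ∧
              ((G n).indepNum : ℝ) ≤ b * (n / Real.log (d n))) ∧
            ∀ fug : ℝ, 1 ≤ fug →
              (metropolisMeasure (Fin (N n))).real
                {ω | ∃ t : ℕ, (t : ℝ) ≤ Real.exp (n / (C' * d n)) ∧
                  C' * (Real.log (d n) / d n) * ((G n).indepNum : ℝ) ≤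
                    ((metropolisProcess (G n) fug ω t).card : ℝ)}
                ≤ Real.exp (-(n / (d n * Real.log (d n)))) := by
  refine ⟨Real.exp 48, 10000, 1 / 4, 10000, Real.exp_pos _, by norm_num, by norm_num, by norm_num,
    fun d hd ho => ?_⟩
  have key : ∀ n : ℕ, ∃ (N : ℕ) (_ : NeZero N) (G : SimpleGraph (Fin N)),
      Real.exp 48 ≤ d n → d n * Real.log (d n) ≤ n →
      (1 / 4 * n ≤ (N : ℝ) ∧ (N : ℝ) ≤ 10000 * n) ∧
      (1 / 4 * d n ≤ averageDegree G ∧ averageDegree G ≤ 10000 * d n) ∧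
      (1 / 4 * (n / Real.log (d n)) ≤ (G.indepNum : ℝ) ∧
        (G.indepNum : ℝ) ≤ 10000 * (n / Real.log (d n))) ∧
      ∀ fug : ℝ, 1 ≤ fug →
        (metropolisMeasure (Fin N)).real
          {ω | ∃ t : ℕ, (t : ℝ) ≤ Real.exp (n / (10000 * d n)) ∧
            10000 * (Real.log (d n) / d n) * (G.indepNum : ℝ) ≤
              ((metropolisProcess G fug ω t).card : ℝ)}
          ≤ Real.exp (-(n / (d n * Real.log (d n)))) := by
    intro n
    by_cases h : Real.exp 48 ≤ d n ∧ d n * Real.log (d n) ≤ n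
    · obtain ⟨N, hN, G, hG⟩ := exists_graph_metropolisProcess_fails n h.1 h.2
      exact ⟨N, hN, G, fun _ _ => hG⟩
    · exact ⟨1, inferInstance, ⊥, fun h1 h2 => absurd ⟨h1, h2⟩ h⟩
  choose N hN G hG using key
  refine ⟨N, hN, G, ?_⟩
  have h1 : ∀ n : ℕ, 1 ≤ n → 1 ≤ d n := fun n hn =>
    (Real.one_le_exp (by norm_num)).trans (hd n hn)
  filter_upwards [eventually_mul_log_le h1 ho, eventually_ge_atTop 1] with n hn hn1
  exact hG n (hd n hn1) hn
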